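/- Let $n\ge 1$ and let $G(t)$, $t=1,2,\dots$, be a sequence of undirected graphs on $\{1,\dots,n\}$, with edge sets $E(t)$, having a self-loop at every node. Let $N_i(t)$ be the set of neighbors of $i$ in $G(t)$ (so $i\in N_i(t)$) and $d_i(t)=|N_i(t)|$. Let $D(i,j,t)$, for $(i,j)\in E(t)$, be real numbers, uniformly bounded from above, with $D(i,j,t)=D(j,i,t)\ge\max(d_i(t),d_j(t))$, and let $D=\sup D(i,j,t)$ over all $t\ge1$ and $(i,j)\in E(t)$. The sequence is called $B$-core-connected if there is a set of edges $E_\infty\subset\bigcup_t E(t)$ such that $(\{1,\dots,n\},E_\infty)$ is connected and $E_\infty\subset\bigcup_{t=kB+1}^{(k+1)B}E(t)$ for every integer $k\ge0$. Fix $\alpha,\beta$ and initial values $x(0)\in\mathbb R^n$. The ternary-message protocol is as follows. Put $R[y]=1$ if $y>1$, $R[y]=-1$ if $y<-1$, and $R[y]=0$ otherwise. Node $i$ keeps a value $x_i$ and, for each $j$, variables $\hat x_{i,j,\rm in},\hat x_{i,j,\rm out}$, equal to $0$ until $(i,j)$ first appears in the sequence. At each iteration $t=1,2,\dots$, for each $(i,j)\in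 E(t)$, node $i$ sends $j$ the message $q_{i\to j}(t)=R\big[t^\alpha(x_i(t-1)-\hat x_{i,j,\rm out}(t-1))\big]$, and $$\hat x_{i,j,\rm out}(t)=\hat x_{i,j,\rm out}(t-1)+\frac{q_{i\to j}(t)}{t^\alpha},\qquad \hat x_{i,j,\rm in}(t)=\hat x_{i,j,\rm in}(t-1)+\frac{q_{j\to i}(t)}{t^\alpha};$$ if $(i,j)\notin E(t)$ both variables stay unchanged. Then $$x_i(t)=x_i(t-1)+\frac1{t^\beta}\sum_{j\in S(i,t)}\frac{\hat x_{i,j,\rm in}(t)-\hat x_{i,j,\rm out}(t)}{4D(i,j,t)},$$ where $S(i,t)$ is the set of $j\in N_i(t)$ with $|\hat x_{i,j,\rm in}(t)-\hat x_{i,j,\rm out}(t)|>4/t^\alpha$ and $q_{i\to j}(t)=q_{j\to i}(t)=0$. For $x\in\mathbb R^n$ let $W(x)=\max_i x_i-\min_i x_i$ and $V_2(x)=\big(\sum_i(x_i-\frac1n\sum_j x_j)^2\big)^{1/2}$; write $W(0)=W(x(0))$, $V_2(0)=V_2(x(0))$, and $\log^+ y=\max(\log y,0)$ for $y>0$, $\log^+0=0$.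 **Theorem.** Let $0<\alpha<\beta<1$. For every $B$-core-connected sequence $G(t)$, all numbers $D(i,j,t)$ as above and all initial values $x(0)$, $$\lim_{t\to\infty}x_i(t)=\frac1n\sum_{j=1}^n x_j(0)\qquad\text{for every node } i .$$ Moreover, for every $\epsilon>0$ and every nonnegative integer $t$ with $$t\ \ge\ 2^{\frac1{1-\beta}}\Big(2^{\frac2{1-\alpha}}\big\lceil 32B+8B\,W(0)\big\rceil^{\frac1{\beta-\alpha}}+\big(32B\|x(0)\|_\infty\big)^{\frac2{1-\alpha}}+11B+\big(300n^3DB\big)^{\frac1{1-\beta}}\Big)+\max\Big(\big(150n^3DB\,\log^+\tfrac{V_2(0)}{\epsilon}\big)^{\frac1{1-\beta}},\ \big(\tfrac{8n^{1.5}}{\epsilon}\big)^{\frac1\alpha}\Big),$$ one has $V_2(x(t))\le\epsilon$. -/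

import Mathlib

open Filter Topology

namespace TernaryConsensus

/-- Edges of the undirected graph at time `t`: those of the simple graph `G t`, together with
a self-loop at every node. -/
def Edge {n : ℕ} (G : ℕ → SimpleGraph (Fin n)) (t : ℕ) (i j : Fin n) : Prop :=
  i = j ∨ (G t).Adj i j

open Classical in
/-- `N_i(t)`: the neighbors of `i` at time `t` (with `i` itself, because of the self-loop). -/
noncomputable def nbrs {n : ℕ} (G : ℕ → SimpleGraph (Fin n)) (t : ℕ) (i : Fin n) :
    Finset (Fin n) :=
  Finset.univ.filter fun j => Edge G t i j

/-- `d_i(t)`: the degree of `i` at time `t`. -/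
noncomputable def deg {n : ℕ} (G : ℕ → SimpleGraph (Fin n)) (t : ℕ) (i : Fin n) : ℕ :=
  (nbrs G t i).card

/-- The numbers `D(i,j,t)`, which matter only at edges and at times `t = 1, 2, …`, are symmetric
and bound the degrees of both endpoints from above. -/
def IsDegreeBound {n : ℕ} (G : ℕ → SimpleGraph (Fin n)) (D : Fin n → Fin n → ℕ → ℝ) : Prop :=
  ∀ t : ℕ, 1 ≤ t → ∀ i j : Fin n, Edge G t i j →
    D i j t = D j i t ∧ max (deg G t i : ℝ) (deg G t j : ℝ) ≤ D i j t

/-- The set of all the numbers `D(i,j,t)`, over times `t ≥ 1` and edges `(i,j)` of `G(t)`. -/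
def degreeBounds {n : ℕ} (G : ℕ → SimpleGraph (Fin n)) (D : Fin n → Fin n → ℕ → ℝ) : Set ℝ :=
  {d | ∃ t : ℕ, 1 ≤ t ∧ ∃ i j : Fin n, Edge G t i j ∧ d = D i j t}

/-- `B`-core-connectedness: there is a set of edges (the edges of `C`), each occurring in the
sequence, which forms a connected graph on all the nodes, and each of which appears during
every block of times `kB+1, …, (k+1)B`. -/
def IsCoreConnected {n : ℕ} (B : ℕ) (G : ℕ → SimpleGraph (Fin n)) : Prop :=
  ∃ C : SimpleGraph (Fin n),
    (∀ i j : Fin n, C.Adj i j → ∃ t : ℕ, 1 ≤ t ∧ (G t).Adj i j) ∧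
    C.Connected ∧
    ∀ k : ℕ, ∀ i j : Fin n, C.Adj i j →
      ∃ t ∈ Finset.Icc (k * B + 1) ((k + 1) * B), (G t).Adj i j

/-- The quantizer `R`, with values in `{-1, 0, 1}`. -/
noncomputable def R (y : ℝ) : SignType :=
  if 1 < y then 1 else if y < -1 then -1 else 0

/-- The variables held by the nodes at a given time. -/
structure State (n : ℕ) where
  /-- `x i` is the value of node `i` -/
  x : Fin n → ℝ
  /-- `xin i j` is the estimate held by `i` of the value of `j` -/
  xin : Fin n → Fin n → ℝ
  /-- `xout i j` is held by `i`, and is built from the messages which `i` sent to `j` -/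
  xout : Fin n → Fin n → ℝ

/-- `q_{i → j}(t)`, the message which `i` sends to `j` at iteration `t` when the state after
iteration `t - 1` is `s`. -/
noncomputable def msg {n : ℕ} (α : ℝ) (t : ℕ) (s : State n) (i j : Fin n) : SignType :=
  R ((t : ℝ) ^ α * (s.x i - s.xout i j))

open Classical in
/-- The outgoing variables after iteration `t`. -/
noncomputable def newOut {n : ℕ} (α : ℝ) (G : ℕ → SimpleGraph (Fin n)) (t : ℕ) (s : State n)
    (i j : Fin n) : ℝ :=
  if Edge G t i j then s.xout i j + (msg α t s i j : ℝ) / (t : ℝ) ^ α else s.xout i j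

open Classical in
/-- The incoming estimates after iteration `t`. -/
noncomputable def newIn {n : ℕ} (α : ℝ) (G : ℕ → SimpleGraph (Fin n)) (t : ℕ) (s : State n)
    (i j : Fin n) : ℝ :=
  if Edge G t i j then s.xin i j + (msg α t s j i : ℝ) / (t : ℝ) ^ α else s.xin i j

open Classical in
/-- `S(i,t)`: the neighbors which node `i` includes in its update at iteration `t`. -/
noncomputable def active {n : ℕ} (α : ℝ) (G : ℕ → SimpleGraph (Fin n)) (t : ℕ) (s : State n)
    (i : Fin n) : Finset (Fin n) :=
  (nbrs G t i).filter fun j =>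
    4 / (t : ℝ) ^ α < |newIn α G t s i j - newOut α G t s i j| ∧
      msg α t s j i = 0 ∧ msg α t s i j = 0

/-- Iteration `t` of the protocol, applied to the state after iteration `t - 1`. -/
noncomputable def step {n : ℕ} (α β : ℝ) (G : ℕ → SimpleGraph (Fin n))
    (D : Fin n → Fin n → ℕ → ℝ) (t : ℕ) (s : State n) : State n where
  x := fun i => s.x i + 1 / (t : ℝ) ^ β *
    ∑ j ∈ active α G t s i, (newIn α G t s i j - newOut α G t s i j) / (4 * D i j t)
  xin := newIn α G t s
  xout := newOut α G t s

/-- The state of the protocol after iteration `t`, from the initial values `x0`. Estimates are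
zero until the first time at which the edge `(i,j)` appears; before it they are not used. -/
noncomputable def run {n : ℕ} (α β : ℝ) (G : ℕ → SimpleGraph (Fin n))
    (D : Fin n → Fin n → ℕ → ℝ) (x0 : Fin n → ℝ) : ℕ → State n
  | 0 => { x := x0, xin := fun _ _ => 0, xout := fun _ _ => 0 }
  | t + 1 => step α β G D (t + 1) (run α β G D x0 t)

/-- The spread `W(x) = max_i x_i - min_i x_i`. -/
noncomputable def W {n : ℕ} (x : Fin n → ℝ) : ℝ := (⨆ i, x i) - ⨅ i, x i

/-- `V₂(x)`: the Euclidean distance of `x` from the constant vector of its average. -/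
noncomputable def V2 {n : ℕ} (x : Fin n → ℝ) : ℝ :=
  Real.sqrt (∑ i, (x i - 1 / (n : ℝ) * ∑ j, x j) ^ 2)

end TernaryConsensus

/-! When both ends of an edge send `0`, each estimate is within `1 / t ^ α` of its value, so the
estimated difference is off by at most `2 / t ^ α`. An update requires it to exceed `4 / t ^ α`,
hence it has the sign and size of the true difference (`ratio_bounds`). However bad the estimates
are, each iteration is therefore a symmetric averaging step with weights of order at most `1 / t ^
β`: the average is conserved and `V2` never increases (`isAveraging_step`).

Progress needs quiet times, without corrections. A value drifts by at most `W x0 / (2 * t ^ β)` per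
step, while a nonzero message shifts an estimate by `1 / t ^ α`. As `α < β`, corrections eventually
dominate the drift over a block of `B` steps, and as `∑ 1 / t ^ α` diverges, any initial error is
absorbed (`exists_tracked`). From then on an estimate is corrected at most once in three blocks, so
each core edge, which carries two estimates, occurs once with no correction (`exists_quiet`).

While `V2` exceeds `3 * n ^ (3 / 2) / t ^ α`, some gap in the sorted values exceeds `6 / t ^ α`
(`exists_cut`). A core edge crosses it and has a quiet time, so averaging across the gap occurs
within three blocks, and `V2` loses a factor `1 - κ / e ^ β`, with `e` the end of the window and `κ
= 1 / (3 n³ D)` (`V2_window`). As `∑ 1 / t ^ β` diverges, `V2` falls to order `1 / t ^ α` (`decay`).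
The time bound collects the waiting times of these phases. -/

namespace TernaryConsensus

/-! ### Symmetric averaging steps and their energy -/

/-- One step of a symmetric averaging scheme, whose weights at a node sum to at most `1/2`. -/
structure IsAveraging {ι : Type*} [Fintype ι] (a : ι → ι → ℝ) (x x' : ι → ℝ) : Prop where
  nonneg : ∀ i j, 0 ≤ a i j
  symm : ∀ i j, a i j = a j i
  row : ∀ i, ∑ j, a i j ≤ 1 / 2
  eq : ∀ i, x' i = x i + ∑ j, a i j * (x j - x i)

namespace IsAveraging

variable {ι : Type*} [Fintype ι] {a : ι → ι → ℝ} {x x' : ι → ℝ}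

lemma neg (h : IsAveraging a x x') : IsAveraging a (fun i => -x i) (fun i => -x' i) where
  nonneg := h.nonneg
  symm := h.symm
  row := h.row
  eq i := by
    rw [h.eq i, neg_add, ← Finset.sum_neg_distrib]
    congr 1
    exact Finset.sum_congr rfl fun j _ => by ring

/-- Exchanging the summation indices, by the symmetry of `a`, turns a sum over nodes into a sum over
edges. A constant `f` gives conservation of the sum, and `f i = x i - c` the energy identity. -/
lemma sum_antisymm (h : IsAveraging a x x') (f : ι → ℝ) :
    2 * ∑ i, f i * ∑ j, a i j * (x j - x i)
      = - ∑ i, ∑ j, a i j * ((f j - f i) * (x j - x i)) := by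
  have h1 : ∑ i, f i * ∑ j, a i j * (x j - x i) = ∑ i, ∑ j, f i * (a i j * (x j - x i)) := by
    simp_rw [Finset.mul_sum]
  have h2 : ∑ i, f i * ∑ j, a i j * (x j - x i) = ∑ i, ∑ j, f j * (a i j * (x i - x j)) := by
    rw [h1, Finset.sum_comm]
    refine Finset.sum_congr rfl fun i _ => Finset.sum_congr rfl fun j _ => ?_
    rw [h.symm j i]
  rw [two_mul]
  nth_rewrite 1 [h1]
  rw [h2, ← Finset.sum_add_distrib, ← Finset.sum_neg_distrib]
  refine Finset.sum_congr rfl fun i _ => ?_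
  rw [← Finset.sum_add_distrib, ← Finset.sum_neg_distrib]
  exact Finset.sum_congr rfl fun j _ => by ring

lemma sum_eq (h : IsAveraging a x x') : ∑ i, x' i = ∑ i, x i := by
  have h1 := h.sum_antisymm fun _ => 1
  simp only [one_mul, sub_self, zero_mul, mul_zero, Finset.sum_const_zero, neg_zero] at h1
  simp_rw [h.eq, Finset.sum_add_distrib]
  linarith

/-- Averaging keeps an upper bound on a set of nodes which does not interact with the others. -/
lemma le_of_closed (h : IsAveraging a x x') {S : Set ι} {M : ℝ}
    (hS : ∀ i ∈ S, ∀ j ∉ S, a i j = 0) (hM : ∀ i ∈ S, x i ≤ M) : ∀ i ∈ S, x' i ≤ M := by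
  intro i hi
  have h1 : ∑ j, a i j * (x j - x i) ≤ ∑ j, a i j * (M - x i) := by
    refine Finset.sum_le_sum fun j _ => ?_
    by_cases hj : j ∈ S
    · exact mul_le_mul_of_nonneg_left (by linarith [hM j hj]) (h.nonneg i j)
    · simp [hS i hi j hj]
  rw [← Finset.sum_mul] at h1
  have h2 : (∑ j, a i j) * (M - x i) ≤ 1 / 2 * (M - x i) :=
    mul_le_mul_of_nonneg_right (h.row i) (by linarith [hM i hi])
  rw [h.eq i]
  linarith [hM i hi]

lemma ge_of_closed (h : IsAveraging a x x') {S : Set ι} {m : ℝ}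
    (hS : ∀ i ∈ S, ∀ j ∉ S, a i j = 0) (hm : ∀ i ∈ S, m ≤ x i) : ∀ i ∈ S, m ≤ x' i := by
  intro i hi
  have := h.neg.le_of_closed hS (M := -m) (fun i hi => neg_le_neg (hm i hi)) i hi
  linarith

lemma le_of_le (h : IsAveraging a x x') {M : ℝ} (hM : ∀ i, x i ≤ M) (i : ι) : x' i ≤ M :=
  h.le_of_closed (S := Set.univ) (by simp) (fun i _ => hM i) i trivial

lemma ge_of_ge (h : IsAveraging a x x') {m : ℝ} (hm : ∀ i, m ≤ x i) (i : ι) : m ≤ x' i :=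
  h.ge_of_closed (S := Set.univ) (by simp) (fun i _ => hm i) i trivial

lemma abs_sub_le (h : IsAveraging a x x') {m M r : ℝ} (hm : ∀ i, m ≤ x i) (hM : ∀ i, x i ≤ M)
    (hr : ∀ i, ∑ j, a i j ≤ r) (i : ι) : |x' i - x i| ≤ r * (M - m) := by
  rw [h.eq i, add_sub_cancel_left]
  calc |∑ j, a i j * (x j - x i)| ≤ ∑ j, |a i j * (x j - x i)| := Finset.abs_sum_le_sum_abs _ _
    _ ≤ ∑ j, a i j * (M - m) := by
        refine Finset.sum_le_sum fun j _ => ?_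
        rw [abs_mul, abs_of_nonneg (h.nonneg i j)]
        refine mul_le_mul_of_nonneg_left ?_ (h.nonneg i j)
        rw [abs_le]
        constructor <;> linarith [hm i, hM i, hm j, hM j]
    _ = (∑ j, a i j) * (M - m) := by rw [Finset.sum_mul]
    _ ≤ r * (M - m) := mul_le_mul_of_nonneg_right (hr i) (by linarith [hm i, hM i])

/-- The cross term of the expanded square is minus the energy, by `sum_antisymm`. Cauchy–Schwarz and
the row sums `≤ 1 / 2` bound the quadratic term by half the energy; the other half is gained. -/
lemma sum_sq_le_energy (h : IsAveraging a x x') (c : ℝ) :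
    ∑ i, (x' i - c) ^ 2
      ≤ ∑ i, (x i - c) ^ 2 - 1 / 2 * ∑ i, ∑ j, a i j * (x j - x i) ^ 2 := by
  have h1 := h.sum_antisymm fun i => x i - c
  have h1' : ∑ i, ∑ j, a i j * ((x j - c - (x i - c)) * (x j - x i))
      = ∑ i, ∑ j, a i j * (x j - x i) ^ 2 :=
    Finset.sum_congr rfl fun i _ => Finset.sum_congr rfl fun j _ => by ring
  rw [h1'] at h1
  have h2 : ∑ i, (∑ j, a i j * (x j - x i)) ^ 2
      ≤ 1 / 2 * ∑ i, ∑ j, a i j * (x j - x i) ^ 2 := by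
    rw [Finset.mul_sum]
    refine Finset.sum_le_sum fun i _ => ?_
    have h3 : (∑ j, a i j * (x j - x i)) ^ 2
        ≤ (∑ j, a i j) * ∑ j, a i j * (x j - x i) ^ 2 :=
      Finset.sum_sq_le_sum_mul_sum_of_sq_le_mul _ (fun j _ => h.nonneg i j)
        (fun j _ => mul_nonneg (h.nonneg i j) (sq_nonneg _)) (fun j _ => le_of_eq (by ring))
    exact h3.trans (mul_le_mul_of_nonneg_right (h.row i)
      (Finset.sum_nonneg fun j _ => mul_nonneg (h.nonneg i j) (sq_nonneg _)))
  have h4 : ∑ i, (x' i - c) ^ 2 = ∑ i, (x i - c) ^ 2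
      + 2 * ∑ i, (x i - c) * ∑ j, a i j * (x j - x i)
      + ∑ i, (∑ j, a i j * (x j - x i)) ^ 2 := by
    rw [Finset.mul_sum, ← Finset.sum_add_distrib, ← Finset.sum_add_distrib]
    exact Finset.sum_congr rfl fun i _ => by rw [h.eq i]; ring
  linarith

lemma energy_nonneg (h : IsAveraging a x x') : 0 ≤ ∑ i, ∑ j, a i j * (x j - x i) ^ 2 :=
  Finset.sum_nonneg fun i _ => Finset.sum_nonneg fun j _ =>
    mul_nonneg (h.nonneg i j) (sq_nonneg _)

/-- Both ordered pairs `(p, q)` and `(q, p)` contribute, which cancels the `1 / 2` of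
`sum_sq_le_energy`. -/
lemma edge_le_energy (h : IsAveraging a x x') {p q : ι} (hpq : p ≠ q) :
    2 * (a p q * (x p - x q) ^ 2) ≤ ∑ i, ∑ j, a i j * (x j - x i) ^ 2 := by
  classical
  have hn : ∀ i j, 0 ≤ a i j * (x j - x i) ^ 2 :=
    fun i j => mul_nonneg (h.nonneg i j) (sq_nonneg _)
  have hr : ∀ i j, a i j * (x j - x i) ^ 2 ≤ ∑ j, a i j * (x j - x i) ^ 2 :=
    fun i j => Finset.single_le_sum (f := fun j => a i j * (x j - x i) ^ 2)
      (fun j _ => hn i j) (Finset.mem_univ j)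
  have hs : ∑ i ∈ {p, q}, ∑ j, a i j * (x j - x i) ^ 2
      ≤ ∑ i, ∑ j, a i j * (x j - x i) ^ 2 :=
    Finset.sum_le_sum_of_subset_of_nonneg (Finset.subset_univ _)
      fun i _ _ => Finset.sum_nonneg fun j _ => hn i j
  rw [Finset.sum_pair hpq] at hs
  have h1 := hr p q
  have h2 := hr q p
  rw [h.symm q p] at h2
  nlinarith

end IsAveraging

/-! ### Dispersion and gaps between the values -/

section Dispersion

variable {n : ℕ} {x x' : Fin n → ℝ}

lemma V2_nonneg (x : Fin n → ℝ) : 0 ≤ V2 x := Real.sqrt_nonneg _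

lemma V2_sq (x : Fin n → ℝ) : V2 x ^ 2 = ∑ i, (x i - 1 / (n : ℝ) * ∑ j, x j) ^ 2 :=
  Real.sq_sqrt (Finset.sum_nonneg fun _ _ => sq_nonneg _)

lemma abs_sub_average_le_V2 (x : Fin n → ℝ) (i : Fin n) :
    |x i - 1 / (n : ℝ) * ∑ j, x j| ≤ V2 x := by
  refine Real.abs_le_sqrt ?_
  exact Finset.single_le_sum (f := fun i => (x i - 1 / (n : ℝ) * ∑ j, x j) ^ 2)
    (fun _ _ => sq_nonneg _) (Finset.mem_univ i)

lemma IsAveraging.V2_sq_le {a : Fin n → Fin n → ℝ} (h : IsAveraging a x x') {p q : Fin n}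
    (hpq : p ≠ q) : V2 x' ^ 2 ≤ V2 x ^ 2 - a p q * (x p - x q) ^ 2 := by
  rw [V2_sq, V2_sq, h.sum_eq]
  linarith [h.sum_sq_le_energy (1 / (n : ℝ) * ∑ j, x j), h.edge_le_energy hpq]

lemma IsAveraging.V2_le {a : Fin n → Fin n → ℝ} (h : IsAveraging a x x') : V2 x' ≤ V2 x := by
  refine Real.sqrt_le_sqrt ?_
  rw [h.sum_eq]
  linarith [h.sum_sq_le_energy (1 / (n : ℝ) * ∑ j, x j), h.energy_nonneg]

/-- The average minimizes the sum of the squared distances. -/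
lemma V2_sq_le_sum (hn : 0 < n) (x : Fin n → ℝ) (c : ℝ) : V2 x ^ 2 ≤ ∑ i, (x i - c) ^ 2 := by
  rw [V2_sq]
  set m := 1 / (n : ℝ) * ∑ j, x j with hm
  have hn' : (n : ℝ) ≠ 0 := by positivity
  have h0 : ∑ i, (x i - m) = 0 := by
    rw [Finset.sum_sub_distrib, Finset.sum_const, Finset.card_univ, Fintype.card_fin,
      nsmul_eq_mul, hm]
    field_simp
    ring
  have h1 : ∑ i, (x i - c) ^ 2
      = ∑ i, (x i - m) ^ 2 + 2 * (m - c) * ∑ i, (x i - m) + ∑ _i : Fin n, (m - c) ^ 2 := by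
    rw [Finset.mul_sum, ← Finset.sum_add_distrib, ← Finset.sum_add_distrib]
    exact Finset.sum_congr rfl fun i _ => by ring
  have h2 : 0 ≤ ∑ _i : Fin n, (m - c) ^ 2 := Finset.sum_nonneg fun _ _ => sq_nonneg _
  rw [h1, h0]
  linarith

lemma V2_sq_le_of_bounds (hn : 0 < n) {m M : ℝ} (hm : ∀ i, m ≤ x i) (hM : ∀ i, x i ≤ M) :
    4 * V2 x ^ 2 ≤ n * (M - m) ^ 2 := by
  have h1 := V2_sq_le_sum hn x ((m + M) / 2)
  have h2 : ∑ i, (x i - (m + M) / 2) ^ 2 ≤ ∑ _i : Fin n, (M - m) ^ 2 / 4 := by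
    refine Finset.sum_le_sum fun i _ => ?_
    nlinarith [mul_nonneg (sub_nonneg.2 (hm i)) (sub_nonneg.2 (hM i))]
  rw [Finset.sum_const, Finset.card_univ, Fintype.card_fin, nsmul_eq_mul] at h2
  linarith

/-- Some gap between consecutive values is at least a `1/n` fraction of the spread. -/
lemma exists_gap {p q : Fin n} (hpq : x p < x q) :
    ∃ lo : ℝ, x p ≤ lo ∧ lo < x q ∧ ∀ i, x i ≤ lo ∨ lo + (x q - x p) / n < x i := by
  by_contra! hcon
  have hn : (0 : ℝ) < n := by exact_mod_cast Fin.pos p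
  set w := (x q - x p) / n with hw
  have hw0 : 0 < w := div_pos (by linarith) hn
  have hwn : w * n = x q - x p := by rw [hw]; field_simp
  -- Without a gap, each of the `n` disjoint intervals `(x p + l * w, x p + l * w + w]` contains a
  -- value. The nodes so chosen are then all the nodes, but `x p` lies in none of the intervals.
  have h1 : ∀ l : Fin n, ∃ i, x p + l * w < x i ∧ x i ≤ x p + l * w + w := by
    intro l
    have hl : ((l : ℕ) : ℝ) + 1 ≤ n := by exact_mod_cast l.2
    refine hcon (x p + l * w) (by nlinarith [Nat.cast_nonneg (α := ℝ) (l : ℕ)]) ?_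
    nlinarith
  choose f hf1 hf2 using h1
  have hinj : Function.Injective f := by
    intro l m hlm
    by_contra hne
    wlog hlt : l < m generalizing l m
    · exact this hlm.symm (Ne.symm hne) (lt_of_le_of_ne (not_lt.1 hlt) (Ne.symm hne))
    have hlt' : ((l : ℕ) : ℝ) + 1 ≤ (m : ℕ) := by exact_mod_cast hlt
    have h2 := hf2 l
    have h3 := hf1 m
    rw [hlm] at h2
    nlinarith
  obtain ⟨l, hl⟩ := (Finite.injective_iff_surjective.1 hinj) p
  have h2 := hf1 l
  rw [hl] at h2
  nlinarith [Nat.cast_nonneg (α := ℝ) (l : ℕ)]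

/-- A non-constant vector splits the nodes into a lower and an upper part with a large gap. -/
lemma exists_cut (hx : 0 < V2 x) :
    ∃ (S : Set (Fin n)) (lo hi : ℝ), S.Nonempty ∧ Sᶜ.Nonempty ∧ (∀ i ∈ S, x i ≤ lo) ∧
      (∀ i ∈ Sᶜ, hi ≤ x i) ∧ lo < hi ∧ 4 * V2 x ^ 2 ≤ (n : ℝ) ^ 3 * (hi - lo) ^ 2 := by
  have hn : 0 < n := by
    rcases Nat.eq_zero_or_pos n with rfl | h
    · simp [V2] at hx
    · exact h
  have : Nonempty (Fin n) := ⟨⟨0, hn⟩⟩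
  obtain ⟨p, hp⟩ := Finite.exists_min x
  obtain ⟨q, hq⟩ := Finite.exists_max x
  have hV := V2_sq_le_of_bounds hn hp hq
  have hpq : x p < x q := by
    refine lt_of_le_of_ne (hp q) fun he => ?_
    rw [he] at hV
    nlinarith
  obtain ⟨lo, h1, h2, h3⟩ := exists_gap hpq
  have hn' : (0 : ℝ) < n := by exact_mod_cast hn
  refine ⟨{i | x i ≤ lo}, lo, lo + (x q - x p) / n, ⟨p, h1⟩, ⟨q, not_le.2 h2⟩, fun i hi => hi,
    fun i hi => ((h3 i).resolve_left hi).le, ?_, ?_⟩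
  · linarith [div_pos (sub_pos.2 hpq) hn']
  · have : (n : ℝ) ^ 3 * (lo + (x q - x p) / n - lo) ^ 2 = n * (x q - x p) ^ 2 := by
      field_simp
      ring
    rw [this]
    exact hV

end Dispersion

/-! ### Power inequalities replacing comparison with integrals -/

section PowerBounds

/-- `s ^ p` grows at most as fast as the linear function with slope `x ^ (p - 1)`. -/
lemma rpow_le_rpow_add {p x y : ℝ} (hp1 : p ≤ 1) (hx : 0 < x) (hxy : x ≤ y) :
    y ^ p ≤ x ^ p + (y - x) * x ^ (p - 1) := by
  have h1 : 1 ≤ y / x := (one_le_div hx).2 hxy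
  have h2 : (y / x) ^ p ≤ y / x := by
    simpa using Real.rpow_le_rpow_of_exponent_le h1 hp1
  rw [Real.div_rpow (hx.le.trans hxy) hx.le, div_le_iff₀ (Real.rpow_pos_of_pos hx p)] at h2
  refine h2.trans (le_of_eq ?_)
  rw [Real.rpow_sub_one hx.ne']
  field_simp
  ring

/-- `s ^ (-p)` decreases at most as fast as `1 / s`. -/
lemma one_div_rpow_le {p x y : ℝ} (hp1 : p ≤ 1) (hx : 0 < x) (hxy : x ≤ y) :
    1 / x ^ p ≤ y / x * (1 / y ^ p) := by
  have hy := hx.trans_le hxy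
  have h1 : 1 ≤ y / x := (one_le_div hx).2 hxy
  have h2 : (y / x) ^ p ≤ y / x := by
    simpa using Real.rpow_le_rpow_of_exponent_le h1 hp1
  rw [Real.div_rpow hy.le hx.le] at h2
  have := Real.rpow_pos_of_pos hx p
  have := Real.rpow_pos_of_pos hy p
  calc 1 / x ^ p = y ^ p / x ^ p * (1 / y ^ p) := by field_simp
    _ ≤ _ := mul_le_mul_of_nonneg_right h2 (by positivity)

lemma one_div_rpow_anti {p x y : ℝ} (hp : 0 ≤ p) (hx : 0 < x) (hxy : x ≤ y) :
    1 / y ^ p ≤ 1 / x ^ p :=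
  one_div_le_one_div_of_le (Real.rpow_pos_of_pos hx p) (Real.rpow_le_rpow hx.le hxy hp)

end PowerBounds

/-! ### Errors of the estimates: corrections against drift -/

/-- The error `h` of an estimate which is corrected by `1 / t ^ α`, at the times `t` in `P` at
which it is larger than this, and drifts by at most `δ t` at any time `t`. -/
structure IsTrackingError (α : ℝ) (δ : ℕ → ℝ) (P : ℕ → Prop) (h : ℕ → ℝ) : Prop where
  drift : ∀ t : ℕ, |h (t + 1)| ≤ |h t| + δ (t + 1)
  correct : ∀ t : ℕ, P (t + 1) → 1 / ((t + 1 : ℕ) : ℝ) ^ α < |h t| →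
    |h (t + 1)| ≤ |h t| - 1 / ((t + 1 : ℕ) : ℝ) ^ α + δ (t + 1)

/-- Over `B` steps the drift from time `s` on is small compared to the corrections. -/
def SlowDrift (α : ℝ) (δ : ℕ → ℝ) (B s : ℕ) : Prop :=
  ∀ t : ℕ, s ≤ t → δ t ≤ 1 / (t : ℝ) ^ α / (16 * B)

namespace IsTrackingError

variable {α : ℝ} {δ : ℕ → ℝ} {P : ℕ → Prop} {h : ℕ → ℝ} {B : ℕ}

lemma abs_le_add (H : IsTrackingError α δ P h) {θ : ℝ} {s e : ℕ}
    (hθ : ∀ t : ℕ, s < t → t ≤ e → δ t ≤ θ) {u v : ℕ} (hsu : s ≤ u) (huv : u ≤ v) (hve : v ≤ e) :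
    |h v| ≤ |h u| + ((v : ℝ) - u) * θ := by
  induction v, huv using Nat.le_induction with
  | base => simp
  | succ v huv ih =>
    have h1 := ih (by omega)
    have h2 := H.drift v
    have h3 := hθ (v + 1) (by omega) hve
    push_cast
    linarith

lemma drift_le (hα : 0 < α) (hB : 0 < B) {s : ℕ} (hs : 0 < s) (hδ : SlowDrift α δ B s) {t : ℕ}
    (ht : s ≤ t) : δ t ≤ 1 / (s : ℝ) ^ α / (16 * B) := by
  refine (hδ t ht).trans ?_
  have : (0 : ℝ) < B := by exact_mod_cast hB
  gcongr

/-- The error after a block of times in which a correction is possible. -/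
lemma block_le (H : IsTrackingError α δ P h) (hα : 0 < α) (hα1 : α ≤ 1) (hB : 0 < B) {k : ℕ}
    (hk : 32 ≤ k) (hδ : SlowDrift α δ B (k * B))
    (hP : ∃ t ∈ Finset.Icc (k * B + 1) ((k + 1) * B), P t) :
    |h ((k + 1) * B)| ≤ |h (k * B)| - 7 / 8 * (1 / (((k + 1) * B : ℕ) : ℝ) ^ α) ∨
      |h ((k + 1) * B)| ≤ 9 / 8 * (1 / (((k + 1) * B : ℕ) : ℝ) ^ α) := by
  obtain ⟨t, ht, hPt⟩ := hP
  rw [Finset.mem_Icc] at ht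
  obtain ⟨u, rfl⟩ : ∃ u, t = u + 1 := ⟨t - 1, by omega⟩
  have hB' : (0 : ℝ) < B := by exact_mod_cast hB
  have hk' : (32 : ℝ) ≤ k := by exact_mod_cast hk
  have hkB : 0 < k * B := Nat.mul_pos (by omega) hB
  have hkB' : (0 : ℝ) < ((k * B : ℕ) : ℝ) := by exact_mod_cast hkB
  set θ := 1 / ((k * B : ℕ) : ℝ) ^ α with hθ
  set b := 1 / (((k + 1) * B : ℕ) : ℝ) ^ α with hb
  have hθ0 : 0 < θ := by positivity
  have hθb : θ ≤ 33 / 32 * b := by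
    have h1 := one_div_rpow_le hα1 hkB' (y := (((k + 1) * B : ℕ) : ℝ))
      (by exact_mod_cast Nat.mul_le_mul_right B (Nat.le_succ k))
    refine h1.trans (mul_le_mul_of_nonneg_right ?_ (by positivity))
    rw [div_le_iff₀ hkB']
    push_cast
    nlinarith
  have hd : ∀ t : ℕ, k * B < t → t ≤ (k + 1) * B → δ t ≤ θ / (16 * B) :=
    fun t h1 _ => drift_le hα hB hkB hδ h1.le
  have hlen : (((k + 1) * B : ℕ) : ℝ) - ((k * B : ℕ) : ℝ) = B := by push_cast; ring
  have hBθ : (B : ℝ) * (θ / (16 * B)) = θ / 16 := by field_simp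
  have h1 := H.abs_le_add hd le_rfl (show k * B ≤ u by omega) (by omega)
  have h2 := H.abs_le_add hd (show k * B ≤ u + 1 by omega) ht.2 le_rfl
  have hlt : 1 / ((u + 1 : ℕ) : ℝ) ^ α ≤ θ :=
    one_div_rpow_anti hα.le hkB' (by exact_mod_cast (by omega : k * B ≤ u + 1))
  have hbt : b ≤ 1 / ((u + 1 : ℕ) : ℝ) ^ α :=
    one_div_rpow_anti hα.le (by positivity) (by exact_mod_cast ht.2)
  have hdu := hd (u + 1) (by omega) ht.2
  have hc : (0 : ℝ) ≤ θ / (16 * B) := by positivity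
  have hu : ((k * B : ℕ) : ℝ) ≤ u := by exact_mod_cast (by omega : k * B ≤ u)
  have e1 : ((u + 1 : ℕ) : ℝ) = u + 1 := by push_cast; ring
  have e2 : (((k + 1) * B : ℕ) : ℝ) = ((k * B : ℕ) : ℝ) + B := by linarith
  rw [e1, e2] at h2
  -- A correction removes at least `b`, and the drift over the block gives back at most `θ / 16 ≤ b
  -- / 8`. Without a correction `|h u| ≤ θ`, and `33 / 32 * (17 / 16) < 9 / 8`.
  by_cases hs : 1 / ((u + 1 : ℕ) : ℝ) ^ α < |h u|
  · left
    have h3 := H.correct u hPt hs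
    nlinarith
  · right
    have h3 := H.drift u
    nlinarith

/-- Once the error is small, it stays so. -/
lemma tracked_of_tracked (H : IsTrackingError α δ P h) (hα : 0 < α) (hα1 : α ≤ 1) (hB : 0 < B)
    {K : ℕ} (hK : 32 ≤ K) (hδ : SlowDrift α δ B (K * B))
    (hP : ∀ k : ℕ, ∃ t ∈ Finset.Icc (k * B + 1) ((k + 1) * B), P t)
    (h0 : |h (K * B)| ≤ 9 / 8 * (1 / ((K * B : ℕ) : ℝ) ^ α)) {k : ℕ} (hk : K ≤ k) :
    |h (k * B)| ≤ 9 / 8 * (1 / ((k * B : ℕ) : ℝ) ^ α) := by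
  induction k, hk using Nat.le_induction with
  | base => exact h0
  | succ k hKk ih =>
    have hle : K * B ≤ k * B := Nat.mul_le_mul_right B hKk
    rcases H.block_le hα hα1 hB (hK.trans hKk) (fun t ht => hδ t (hle.trans ht)) (hP k) with h1 | h1
    · have hk' : (32 : ℝ) ≤ k := by exact_mod_cast hK.trans hKk
      have hB' : (0 : ℝ) < B := by exact_mod_cast hB
      have hkB' : (0 : ℝ) < ((k * B : ℕ) : ℝ) := by
        exact_mod_cast Nat.mul_pos (by omega : 0 < k) hB
      have h2 := one_div_rpow_le hα1 hkB' (y := (((k + 1) * B : ℕ) : ℝ))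
        (by exact_mod_cast Nat.mul_le_mul_right B (Nat.le_succ k))
      have h3 : (((k + 1) * B : ℕ) : ℝ) / ((k * B : ℕ) : ℝ) ≤ 33 / 32 := by
        rw [div_le_iff₀ hkB']
        push_cast
        nlinarith
      have h4 : (0 : ℝ) ≤ 1 / (((k + 1) * B : ℕ) : ℝ) ^ α := by positivity
      have h5 := h2.trans (mul_le_mul_of_nonneg_right h3 h4)
      linarith
    · exact h1

/-- The error becomes small within the time it takes to make the required corrections. -/
lemma exists_tracked (H : IsTrackingError α δ P h) (hα : 0 < α) (hα1 : α ≤ 1) (hB : 0 < B)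
    {k₀ K : ℕ} (hk₀ : 32 ≤ k₀) (hkK : k₀ ≤ K) (hδ : SlowDrift α δ B (k₀ * B))
    (hP : ∀ k : ℕ, ∃ t ∈ Finset.Icc (k * B + 1) ((k + 1) * B), P t) {c : ℝ}
    (hc : |h (k₀ * B)| ≤ c)
    (hlong : 8 / 7 * (B * c) <
      (((K + 1) * B : ℕ) : ℝ) ^ (1 - α) - (((k₀ + 1) * B : ℕ) : ℝ) ^ (1 - α)) :
    |h (K * B)| ≤ 9 / 8 * (1 / ((K * B : ℕ) : ℝ) ^ α) := by
  have hB' : (0 : ℝ) < B := by exact_mod_cast hB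
  -- Until the error is small, the potential `8 / 7 * (B * |h (k * B)|) + ((k + 1) * B) ^ (1 - α)`
  -- does not increase: a block removes `7 / 8 / ((k + 1) * B) ^ α` from the error, and the power
  -- grows by at most `B / ((k + 1) * B) ^ α`.
  have key : |h (K * B)| ≤ 9 / 8 * (1 / ((K * B : ℕ) : ℝ) ^ α) ∨
      8 / 7 * (B * |h (K * B)|) ≤ 8 / 7 * (B * c) -
        ((((K + 1) * B : ℕ) : ℝ) ^ (1 - α) - (((k₀ + 1) * B : ℕ) : ℝ) ^ (1 - α)) := by
    clear hlong
    induction K, hkK using Nat.le_induction with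
    | base =>
      right
      rw [sub_self, sub_zero]
      gcongr
    | succ k hk ih =>
      have hle : k₀ * B ≤ k * B := Nat.mul_le_mul_right B hk
      have hδ' : SlowDrift α δ B (k * B) := fun t ht => hδ t (hle.trans ht)
      rcases ih with ih | ih
      · exact Or.inl (H.tracked_of_tracked hα hα1 hB (hk₀.trans hk) hδ' hP ih (Nat.le_succ k))
      · rcases H.block_le hα hα1 hB (hk₀.trans hk) hδ' (hP k) with h1 | h1
        · right
          have hx : (0 : ℝ) < (((k + 1) * B : ℕ) : ℝ) := by positivity
          have h2 := rpow_le_rpow_add (p := 1 - α) (by linarith) hx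
            (y := (((k + 1 + 1) * B : ℕ) : ℝ))
            (by exact_mod_cast Nat.mul_le_mul_right B (Nat.le_succ (k + 1)))
          have h3 : (((k + 1 + 1) * B : ℕ) : ℝ) - (((k + 1) * B : ℕ) : ℝ) = B := by
            push_cast; ring
          have h4 : (((k + 1) * B : ℕ) : ℝ) ^ (1 - α - 1)
              = 1 / (((k + 1) * B : ℕ) : ℝ) ^ α := by
            rw [show 1 - α - 1 = -α by ring, Real.rpow_neg hx.le, one_div]
          rw [h3, h4] at h2
          nlinarith [mul_le_mul_of_nonneg_left h1 hB'.le]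
        · exact Or.inl h1
  refine key.resolve_right fun hbad => ?_
  have : 0 ≤ (B : ℝ) * |h (K * B)| := by positivity
  linarith

/-- No two corrections are made within three blocks of times. -/
lemma not_correct_twice (H : IsTrackingError α δ P h) (hα : 0 < α) (hα1 : α ≤ 1) (hB : 0 < B)
    {k : ℕ} (hk : 32 ≤ k) (hδ : SlowDrift α δ B (k * B))
    (h0 : |h (k * B)| ≤ 9 / 8 * (1 / ((k * B : ℕ) : ℝ) ^ α)) {u v : ℕ} (hu : k * B ≤ u)
    (huv : u < v) (hv : v < (k + 3) * B) (hPu : P (u + 1))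
    (h1 : 1 / ((u + 1 : ℕ) : ℝ) ^ α < |h u|) : |h v| ≤ 1 / ((v + 1 : ℕ) : ℝ) ^ α := by
  have hB' : (0 : ℝ) < B := by exact_mod_cast hB
  have hk' : (32 : ℝ) ≤ k := by exact_mod_cast hk
  have hkB : 0 < k * B := Nat.mul_pos (by omega) hB
  have hkB' : (0 : ℝ) < ((k * B : ℕ) : ℝ) := by exact_mod_cast hkB
  set θ := 1 / ((k * B : ℕ) : ℝ) ^ α with hθ
  have hθ0 : 0 < θ := by positivity
  have hsize : ∀ w : ℕ, k * B ≤ w → w ≤ (k + 3) * B → θ ≤ 35 / 32 * (1 / (w : ℝ) ^ α) := by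
    intro w hw1 hw2
    refine (one_div_rpow_le hα1 hkB' (y := (w : ℝ)) (by exact_mod_cast hw1)).trans
      (mul_le_mul_of_nonneg_right ?_ (by positivity))
    rw [div_le_iff₀ hkB']
    have : (w : ℝ) ≤ (((k + 3) * B : ℕ) : ℝ) := by exact_mod_cast hw2
    push_cast at this ⊢
    nlinarith
  have hd : ∀ t : ℕ, k * B < t → t ≤ (k + 3) * B → δ t ≤ θ / (16 * B) :=
    fun t h1 _ => drift_le hα hB hkB hδ h1.le
  have hBθ : (B : ℝ) * (θ / (16 * B)) = θ / 16 := by field_simp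
  have hc : (0 : ℝ) ≤ θ / (16 * B) := by positivity
  have h2 := H.abs_le_add hd le_rfl hu (by omega)
  have h3 := H.correct u hPu h1
  have h4 := H.abs_le_add hd (show k * B ≤ u + 1 by omega) huv hv.le
  have h5 := hd (u + 1) (by omega) (by omega)
  have h6 := hsize (u + 1) (by omega) (by omega)
  have h7 := hsize (v + 1) (by omega) (by omega)
  have hv' : (v : ℝ) ≤ ((k * B : ℕ) : ℝ) + 3 * B := by
    have : (v : ℝ) ≤ (((k + 3) * B : ℕ) : ℝ) := by exact_mod_cast hv.le
    push_cast at this ⊢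
    linarith
  have e1 : ((u + 1 : ℕ) : ℝ) = u + 1 := by push_cast; ring
  rw [e1] at h4
  -- At most `(9 / 8 + 3 / 16 - 32 / 35) * θ < θ / 2` is left of the error.
  nlinarith

/-- Among three consecutive blocks of times there is one at which neither of two estimates is
corrected. -/
lemma exists_quiet {h' : ℕ → ℝ} (H : IsTrackingError α δ P h) (H' : IsTrackingError α δ P h')
    (hα : 0 < α) (hα1 : α ≤ 1) (hB : 0 < B) {k : ℕ} (hk : 32 ≤ k)
    (hδ : SlowDrift α δ B (k * B))
    (hP : ∀ k : ℕ, ∃ t ∈ Finset.Icc (k * B + 1) ((k + 1) * B), P t)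
    (h0 : |h (k * B)| ≤ 9 / 8 * (1 / ((k * B : ℕ) : ℝ) ^ α))
    (h0' : |h' (k * B)| ≤ 9 / 8 * (1 / ((k * B : ℕ) : ℝ) ^ α)) :
    ∃ u : ℕ, k * B ≤ u ∧ u < (k + 3) * B ∧ P (u + 1) ∧
      |h u| ≤ 1 / ((u + 1 : ℕ) : ℝ) ^ α ∧ |h' u| ≤ 1 / ((u + 1 : ℕ) : ℝ) ^ α := by
  have hP' : ∀ k : ℕ, ∃ u : ℕ, k * B ≤ u ∧ u < (k + 1) * B ∧ P (u + 1) := by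
    intro k
    obtain ⟨t, ht, hPt⟩ := hP k
    rw [Finset.mem_Icc] at ht
    exact ⟨t - 1, by omega, by omega, by rwa [Nat.sub_add_cancel (by omega)]⟩
  obtain ⟨u₁, a₁, b₁, p₁⟩ := hP' k
  obtain ⟨u₂, a₂, b₂, p₂⟩ := hP' (k + 1)
  obtain ⟨u₃, a₃, b₃, p₃⟩ := hP' (k + 1 + 1)
  have e1 : (k + 1) * B = k * B + B := by ring
  have e2 : (k + 1 + 1) * B = k * B + 2 * B := by ring
  have e3 : (k + 1 + 1 + 1) * B = k * B + 3 * B := by ring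
  have e4 : (k + 3) * B = k * B + 3 * B := by ring
  have c : ∀ {u v : ℕ}, k * B ≤ u → u < v → v < (k + 3) * B → P (u + 1) →
      1 / ((u + 1 : ℕ) : ℝ) ^ α < |h u| → |h v| ≤ 1 / ((v + 1 : ℕ) : ℝ) ^ α :=
    fun a b c d e => H.not_correct_twice hα hα1 hB hk hδ h0 a b c d e
  have c' : ∀ {u v : ℕ}, k * B ≤ u → u < v → v < (k + 3) * B → P (u + 1) →
      1 / ((u + 1 : ℕ) : ℝ) ^ α < |h' u| → |h' v| ≤ 1 / ((v + 1 : ℕ) : ℝ) ^ α :=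
    fun a b c d e => H'.not_correct_twice hα hα1 hB hk hδ h0' a b c d e
  -- The edge occurs in each of three blocks. Were there a correction at each occurrence, one of the
  -- two estimates would be corrected twice.
  by_contra! hcon
  have q₁ := hcon u₁ a₁ (by omega) p₁
  have q₂ := hcon u₂ (by omega) (by omega) p₂
  have q₃ := hcon u₃ (by omega) (by omega) p₃
  by_cases s₁ : 1 / ((u₁ + 1 : ℕ) : ℝ) ^ α < |h u₁|
  · have r₂ := q₂ (c a₁ (by omega) (by omega) p₁ s₁)
    have r₃ := q₃ (c a₁ (by omega) (by omega) p₁ s₁)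
    exact absurd r₃ (not_lt.2 (c' (by omega) (by omega) (by omega) p₂ r₂))
  · have r₁ := q₁ (not_lt.1 s₁)
    have t₂ := c' a₁ (show u₁ < u₂ by omega) (by omega) p₁ r₁
    have t₃ := c' a₁ (show u₁ < u₃ by omega) (by omega) p₁ r₁
    have r₂ : 1 / ((u₂ + 1 : ℕ) : ℝ) ^ α < |h u₂| := by
      by_contra hn
      exact absurd (q₂ (not_lt.1 hn)) (not_lt.2 t₂)
    exact absurd (q₃ (c (by omega) (by omega) (by omega) p₂ r₂)) (not_lt.2 t₃)

end IsTrackingError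

/-! ### The quantizer -/

lemma R_eq_zero_iff {y : ℝ} : R y = 0 ↔ |y| ≤ 1 := by
  unfold R
  rw [abs_le]
  split_ifs with h1 h2
  · simp; intro; linarith
  · simp; intro; linarith
  · simp; constructor <;> linarith

/-- A correction has the sign of `e` and is smaller than `|e|`, so it does not overshoot. -/
lemma abs_sub_R_div {T e : ℝ} (hT : 0 < T) (he : 1 / T < |e|) :
    |e - (R (T * e) : ℝ) / T| = |e| - 1 / T := by
  have hT' : 0 < 1 / T := by positivity
  rcases le_or_gt 0 e with h0 | h0
  · rw [abs_of_nonneg h0] at he ⊢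
    have h1 : 1 < T * e := by rw [div_lt_iff₀ hT] at he; linarith
    simp only [R, h1, if_true, SignType.coe_one]
    rw [abs_of_nonneg (by linarith)]
  · rw [abs_of_neg h0] at he ⊢
    have h1 : T * e < -1 := by rw [div_lt_iff₀ hT] at he; linarith
    have h2 : ¬ 1 < T * e := by linarith
    simp only [R, h1, h2, if_true, if_false, SignType.coe_neg_one]
    rw [neg_div, sub_neg_eq_add, abs_of_nonpos (by linarith)]
    ring

lemma R_mul_eq_zero_iff {T e : ℝ} (hT : 0 < T) : R (T * e) = 0 ↔ |e| ≤ 1 / T := by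
  rw [R_eq_zero_iff, abs_mul, abs_of_pos hT, le_div_iff₀ hT, mul_comm]

/-- An approximation `z` of `d` with `|z|` large has the sign and the order of magnitude of `d`. -/
lemma ratio_bounds {z d e : ℝ} (h1 : |z - d| ≤ 2 * e) (h2 : 4 * e < |z|) :
    d ≠ 0 ∧ 2 / 3 ≤ z / d ∧ z / d ≤ 2 := by
  have he : 0 ≤ e := by linarith [abs_nonneg (z - d)]
  rw [abs_le] at h1
  rcases le_or_gt 0 z with hz | hz
  · rw [abs_of_nonneg hz] at h2
    have hd : 0 < d := by linarith
    rw [le_div_iff₀ hd, div_le_iff₀ hd]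
    exact ⟨hd.ne', by linarith, by linarith⟩
  · rw [abs_of_neg hz] at h2
    have hd : d < 0 := by linarith
    rw [le_div_iff_of_neg hd, div_le_iff_of_neg hd]
    exact ⟨hd.ne, by linarith, by linarith⟩

/-! ### One iteration as an averaging step -/

section Step

variable {n : ℕ} {α β : ℝ} {G : ℕ → SimpleGraph (Fin n)} {D : Fin n → Fin n → ℕ → ℝ} {t : ℕ}
  {s : State n}

lemma Edge.symm {i j : Fin n} (h : Edge G t i j) : Edge G t j i :=
  h.imp Eq.symm SimpleGraph.Adj.symm

lemma mem_active {i j : Fin n} : j ∈ active α G t s i ↔ Edge G t i j ∧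
    4 / (t : ℝ) ^ α < |newIn α G t s i j - newOut α G t s i j| ∧
      msg α t s j i = 0 ∧ msg α t s i j = 0 := by
  simp [active, nbrs]

/-- Both variables are moved by the same message at the same times, so the two ends of a link keep
agreeing. This makes `active` and the weights symmetric. -/
lemma newIn_eq_newOut (hs : ∀ i j, s.xin i j = s.xout j i) (i j : Fin n) :
    newIn α G t s i j = newOut α G t s j i := by
  unfold newIn newOut
  by_cases h : Edge G t i j
  · rw [if_pos h, if_pos h.symm, hs]
  · rw [if_neg h, if_neg (fun h' => h h'.symm), hs]

lemma active_comm (hs : ∀ i j, s.xin i j = s.xout j i) {i j : Fin n} :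
    j ∈ active α G t s i ↔ i ∈ active α G t s j := by
  rw [mem_active, mem_active, newIn_eq_newOut hs, newIn_eq_newOut hs, abs_sub_comm]
  constructor <;> exact fun ⟨h1, h2, h3, h4⟩ => ⟨h1.symm, h2, h4, h3⟩

lemma msg_eq_zero_iff (ht : 1 ≤ t) {i j : Fin n} :
    msg α t s i j = 0 ↔ |s.x i - s.xout i j| ≤ 1 / (t : ℝ) ^ α :=
  R_mul_eq_zero_iff (Real.rpow_pos_of_pos (by exact_mod_cast ht) α)

lemma newOut_eq_of_msg {i j : Fin n} (h : msg α t s i j = 0) :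
    newOut α G t s i j = s.xout i j := by
  simp [newOut, h]

lemma newOut_error_le (ht : 1 ≤ t) (i j : Fin n) :
    |s.x i - newOut α G t s i j| ≤ |s.x i - s.xout i j| := by
  have hT : 0 < (t : ℝ) ^ α := Real.rpow_pos_of_pos (by exact_mod_cast ht) α
  by_cases hm : msg α t s i j = 0
  · rw [newOut_eq_of_msg hm]
  · unfold newOut
    split_ifs
    · rw [msg_eq_zero_iff ht, not_le] at hm
      rw [← sub_sub, msg, abs_sub_R_div hT hm]
      have : 0 < 1 / (t : ℝ) ^ α := by positivity
      linarith
    · exact le_rfl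

lemma newOut_error_eq (ht : 1 ≤ t) {i j : Fin n} (he : Edge G t i j)
    (hm : 1 / (t : ℝ) ^ α < |s.x i - s.xout i j|) :
    |s.x i - newOut α G t s i j| = |s.x i - s.xout i j| - 1 / (t : ℝ) ^ α := by
  have hT : 0 < (t : ℝ) ^ α := Real.rpow_pos_of_pos (by exact_mod_cast ht) α
  rw [newOut, if_pos he, ← sub_sub, msg, abs_sub_R_div hT hm]

/-- A correction moves the estimate towards `s.x i` without passing it. -/
lemma abs_newOut_le (ht : 1 ≤ t) {r : ℝ} {i j : Fin n} (hx : |s.x i| ≤ r)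
    (ho : |s.xout i j| ≤ r) : |newOut α G t s i j| ≤ r := by
  have hT : 0 < (t : ℝ) ^ α := Real.rpow_pos_of_pos (by exact_mod_cast ht) α
  by_cases hm : msg α t s i j = 0
  · rwa [newOut_eq_of_msg hm]
  · unfold newOut
    split_ifs
    · rw [msg_eq_zero_iff ht, not_le] at hm
      have hT' : 0 < 1 / (t : ℝ) ^ α := by positivity
      rw [msg]
      set e := s.x i - s.xout i j with he
      rw [abs_le] at hx ho ⊢
      rcases le_or_gt 0 e with h0 | h0
      · rw [abs_of_nonneg h0] at hm
        have h1 : 1 < (t : ℝ) ^ α * e := by rw [div_lt_iff₀ hT] at hm; linarith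
        simp only [R, h1, if_true, SignType.coe_one]
        constructor <;> linarith
      · rw [abs_of_neg h0] at hm
        have h1 : (t : ℝ) ^ α * e < -1 := by rw [div_lt_iff₀ hT] at hm; linarith
        have h2 : ¬ 1 < (t : ℝ) ^ α * e := by linarith
        simp only [R, h1, h2, if_true, if_false, SignType.coe_neg_one, neg_div]
        constructor <;> linarith
    · exact ho

/-- The difference of the estimates at a pair of nodes which send the message `0`. -/
lemma abs_estimate_sub_le (ht : 1 ≤ t) (hs : ∀ i j, s.xin i j = s.xout j i) {i j : Fin n}
    (h1 : msg α t s i j = 0) (h2 : msg α t s j i = 0) :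
    |newIn α G t s i j - newOut α G t s i j - (s.x j - s.x i)| ≤ 2 * (1 / (t : ℝ) ^ α) := by
  rw [newIn_eq_newOut hs, newOut_eq_of_msg h1, newOut_eq_of_msg h2]
  rw [msg_eq_zero_iff ht, abs_le] at h1 h2
  rw [abs_le]
  constructor <;> linarith

/-- The update of the values, as an averaging step: the weight which node `i` gives to the
difference between the value of `j` and its own. -/
noncomputable def weight (α β : ℝ) (G : ℕ → SimpleGraph (Fin n)) (D : Fin n → Fin n → ℕ → ℝ)
    (t : ℕ) (s : State n) (i j : Fin n) : ℝ :=
  open Classical in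
  if j ∈ active α G t s i then
    (newIn α G t s i j - newOut α G t s i j) / (s.x j - s.x i) / (4 * D i j t) / (t : ℝ) ^ β
  else 0

lemma ratio_of_active (ht : 1 ≤ t) (hs : ∀ i j, s.xin i j = s.xout j i) {i j : Fin n}
    (h : j ∈ active α G t s i) : s.x j - s.x i ≠ 0 ∧
      2 / 3 ≤ (newIn α G t s i j - newOut α G t s i j) / (s.x j - s.x i) ∧
      (newIn α G t s i j - newOut α G t s i j) / (s.x j - s.x i) ≤ 2 := by
  obtain ⟨_, h2, h3, h4⟩ := mem_active.1 h
  refine ratio_bounds (abs_estimate_sub_le ht hs h4 h3) (lt_of_le_of_lt (le_of_eq ?_) h2)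
  ring

lemma one_le_deg (i : Fin n) : 1 ≤ deg G t i := by
  refine Finset.card_pos.2 ⟨i, ?_⟩
  have h : Edge G t i i := Or.inl rfl
  simp [nbrs, h]

lemma deg_le (hD : IsDegreeBound G D) (ht : 1 ≤ t) {i j : Fin n} (h : Edge G t i j) :
    (deg G t i : ℝ) ≤ D i j t :=
  (le_max_left _ _).trans (hD t ht i j h).2

lemma one_le_D (hD : IsDegreeBound G D) (ht : 1 ≤ t) {i j : Fin n} (h : Edge G t i j) :
    1 ≤ D i j t :=
  le_trans (by exact_mod_cast one_le_deg i) (deg_le hD ht h)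

variable (hD : IsDegreeBound G D) (ht : 1 ≤ t) (hs : ∀ i j, s.xin i j = s.xout j i)
include hD ht hs

/-- The ratio of the estimated to the true difference is in `[2 / 3, 2]`. The upper bound replaces
`D i j t` by the smaller degree, so that the row sums can be bounded. -/
lemma weight_bounds {i j : Fin n} (h : j ∈ active α G t s i) :
    2 / 3 / (4 * D i j t) / (t : ℝ) ^ β ≤ weight α β G D t s i j ∧
      weight α β G D t s i j ≤ 2 / (4 * deg G t i) / (t : ℝ) ^ β := by
  have he := (mem_active.1 h).1
  have h1 := one_le_D hD ht he
  have h2 := deg_le hD ht he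
  have h3 : (1 : ℝ) ≤ deg G t i := by exact_mod_cast one_le_deg i
  have hT : 0 < (t : ℝ) ^ β := Real.rpow_pos_of_pos (by exact_mod_cast ht) β
  obtain ⟨_, h4, h5⟩ := ratio_of_active ht hs h
  rw [weight, if_pos h]
  constructor
  · gcongr
  · gcongr

lemma weight_nonneg (i j : Fin n) : 0 ≤ weight α β G D t s i j := by
  by_cases h : j ∈ active α G t s i
  · have h1 := one_le_D hD ht (mem_active.1 h).1
    have hT : 0 < (t : ℝ) ^ β := Real.rpow_pos_of_pos (by exact_mod_cast ht) β
    refine le_trans ?_ (weight_bounds hD ht hs h).1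
    positivity
  · rw [weight, if_neg h]

lemma weight_comm (i j : Fin n) : weight α β G D t s i j = weight α β G D t s j i := by
  by_cases h : j ∈ active α G t s i
  · have h' := (active_comm hs).1 h
    rw [weight, weight, if_pos h, if_pos h', newIn_eq_newOut hs, newIn_eq_newOut hs,
      (hD t ht i j (mem_active.1 h).1).1]
    rw [← neg_sub (newOut α G t s i j), ← neg_sub (s.x i), neg_div_neg_eq]
  · rw [weight, weight, if_neg h, if_neg fun h' => h ((active_comm hs).2 h')]

lemma sum_weight_le (i : Fin n) : ∑ j, weight α β G D t s i j ≤ 1 / (2 * (t : ℝ) ^ β) := by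
  classical
  have hT : 0 < (t : ℝ) ^ β := Real.rpow_pos_of_pos (by exact_mod_cast ht) β
  have h3 : (1 : ℝ) ≤ deg G t i := by exact_mod_cast one_le_deg i
  have h1 : ∑ j, weight α β G D t s i j = ∑ j ∈ active α G t s i, weight α β G D t s i j := by
    refine (Finset.sum_subset (Finset.subset_univ _) fun j _ hj => ?_).symm
    rw [weight, if_neg hj]
  rw [h1]
  have h4 : ((active α G t s i).card : ℝ) ≤ deg G t i := by
    exact_mod_cast Finset.card_le_card (Finset.filter_subset _ _)
  calc ∑ j ∈ active α G t s i, weight α β G D t s i j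
      ≤ ∑ _j ∈ active α G t s i, 2 / (4 * deg G t i) / (t : ℝ) ^ β :=
        Finset.sum_le_sum fun j hj => (weight_bounds hD ht hs hj).2
    _ = (active α G t s i).card * (2 / (4 * deg G t i) / (t : ℝ) ^ β) := by
        rw [Finset.sum_const, nsmul_eq_mul]
    _ ≤ deg G t i * (2 / (4 * deg G t i) / (t : ℝ) ^ β) := by gcongr
    _ = 1 / (2 * (t : ℝ) ^ β) := by field_simp; norm_num

lemma isAveraging_step (hβ : 0 ≤ β) :
    IsAveraging (weight α β G D t s) s.x (step α β G D t s).x where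
  nonneg := weight_nonneg hD ht hs
  symm := weight_comm hD ht hs
  row i := by
    refine (sum_weight_le hD ht hs i).trans ?_
    have : 1 ≤ (t : ℝ) ^ β := Real.one_le_rpow (by exact_mod_cast ht) hβ
    gcongr
    linarith
  eq i := by
    classical
    have h1 : ∑ j, weight α β G D t s i j * (s.x j - s.x i)
        = ∑ j ∈ active α G t s i, weight α β G D t s i j * (s.x j - s.x i) := by
      refine (Finset.sum_subset (Finset.subset_univ _) fun j _ hj => ?_).symm
      rw [weight, if_neg hj, zero_mul]
    rw [h1]
    simp only [step]
    rw [Finset.mul_sum]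
    congr 1
    refine Finset.sum_congr rfl fun j hj => ?_
    have h2 := (ratio_of_active ht hs hj).1
    have h3 := one_le_D hD ht (mem_active.1 hj).1
    have hT : 0 < (t : ℝ) ^ β := Real.rpow_pos_of_pos (by exact_mod_cast ht) β
    rw [weight, if_pos hj]
    field_simp

lemma weight_ge_of_ne_zero {Dm : ℝ} {i j : Fin n} (h : weight α β G D t s i j ≠ 0)
    (hDm : ∀ i j, Edge G t i j → D i j t ≤ Dm) :
    1 / (6 * Dm * (t : ℝ) ^ β) ≤ weight α β G D t s i j := by
  have ha : j ∈ active α G t s i := by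
    by_contra hn
    exact h (by rw [weight, if_neg hn])
  have he := (mem_active.1 ha).1
  have h1 := one_le_D hD ht he
  have h2 := hDm i j he
  have hT : 0 < (t : ℝ) ^ β := Real.rpow_pos_of_pos (by exact_mod_cast ht) β
  refine le_trans ?_ (weight_bounds hD ht hs ha).1
  have h3 : 2 / 3 / (4 * D i j t) / (t : ℝ) ^ β = 1 / (6 * D i j t * (t : ℝ) ^ β) := by
    field_simp
    norm_num
  rw [h3]
  gcongr

/-- Losing `2 / t ^ α` to the estimation error leaves more than the threshold `4 / t ^ α` of
`active`. -/
lemma weight_ne_zero {i j : Fin n} (he : Edge G t i j) (h1 : msg α t s i j = 0)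
    (h2 : msg α t s j i = 0) (hx : 6 / (t : ℝ) ^ α < |s.x j - s.x i|) :
    weight α β G D t s i j ≠ 0 := by
  have hT : 0 < (t : ℝ) ^ β := Real.rpow_pos_of_pos (by exact_mod_cast ht) β
  have h3 := abs_estimate_sub_le (G := G) ht hs h1 h2
  have ha : j ∈ active α G t s i := by
    refine mem_active.2 ⟨he, ?_, h2, h1⟩
    have h4 := abs_sub_abs_le_abs_sub (s.x j - s.x i)
      (newIn α G t s i j - newOut α G t s i j)
    rw [abs_sub_comm (newIn α G t s i j - newOut α G t s i j)] at h3
    have h5 : 6 / (t : ℝ) ^ α = 4 / (t : ℝ) ^ α + 2 * (1 / (t : ℝ) ^ α) := by ring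
    linarith
  have h4 := one_le_D hD ht he
  refine (lt_of_lt_of_le ?_ (weight_bounds hD ht hs ha).1).ne'
  positivity

end Step

/-! ### Invariants along the run -/

section Run

variable {n : ℕ} {α β : ℝ} {G : ℕ → SimpleGraph (Fin n)} {D : Fin n → Fin n → ℕ → ℝ}
  {x0 : Fin n → ℝ}

lemma run_xin_eq_xout (t : ℕ) (i j : Fin n) :
    (run α β G D x0 t).xin i j = (run α β G D x0 t).xout j i := by
  induction t generalizing i j with
  | zero => rfl
  | succ t ih => exact newIn_eq_newOut ih i j

/-- The weights of the averaging step which leads to time `t + 1`. -/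
noncomputable def runWeight (α β : ℝ) (G : ℕ → SimpleGraph (Fin n))
    (D : Fin n → Fin n → ℕ → ℝ) (x0 : Fin n → ℝ) (t : ℕ) : Fin n → Fin n → ℝ :=
  weight α β G D (t + 1) (run α β G D x0 t)

variable (hD : IsDegreeBound G D) (hβ : 0 ≤ β)
include hD hβ

lemma isAveraging_run (t : ℕ) :
    IsAveraging (runWeight α β G D x0 t) (run α β G D x0 t).x (run α β G D x0 (t + 1)).x :=
  isAveraging_step hD (Nat.le_add_left 1 t) (run_xin_eq_xout t) hβ

lemma sum_run (t : ℕ) : ∑ i, (run α β G D x0 t).x i = ∑ i, x0 i := by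
  induction t with
  | zero => rfl
  | succ t ih => rw [(isAveraging_run hD hβ t).sum_eq, ih]

lemma run_le {M : ℝ} (hM : ∀ i, x0 i ≤ M) (t : ℕ) : ∀ i, (run α β G D x0 t).x i ≤ M := by
  induction t with
  | zero => exact hM
  | succ t ih => exact (isAveraging_run hD hβ t).le_of_le ih

lemma le_run {m : ℝ} (hm : ∀ i, m ≤ x0 i) (t : ℕ) : ∀ i, m ≤ (run α β G D x0 t).x i := by
  induction t with
  | zero => exact hm
  | succ t ih => exact (isAveraging_run hD hβ t).ge_of_ge ih

lemma V2_run_antitone : Antitone fun t => V2 (run α β G D x0 t).x :=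
  antitone_nat_of_succ_le fun t => (isAveraging_run hD hβ t).V2_le

lemma abs_run_le (t : ℕ) (i : Fin n) : |(run α β G D x0 t).x i| ≤ ‖x0‖ := by
  have h : ∀ i, |x0 i| ≤ ‖x0‖ := fun i => norm_le_pi_norm x0 i
  exact abs_le.2 ⟨le_run hD hβ (fun i => (abs_le.1 (h i)).1) t i,
    run_le hD hβ (fun i => (abs_le.1 (h i)).2) t i⟩

lemma abs_run_xout_le (t : ℕ) (i j : Fin n) : |(run α β G D x0 t).xout i j| ≤ ‖x0‖ := by
  induction t with
  | zero => simp [run]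
  | succ t ih => exact abs_newOut_le (Nat.le_add_left 1 t) (abs_run_le hD hβ t i) ih

lemma abs_run_succ_sub_le (t : ℕ) (i : Fin n) :
    |(run α β G D x0 (t + 1)).x i - (run α β G D x0 t).x i|
      ≤ 1 / (2 * ((t + 1 : ℕ) : ℝ) ^ β) * W x0 :=
  (isAveraging_run hD hβ t).abs_sub_le
    (le_run hD hβ (ciInf_le (Set.finite_range x0).bddBelow) t)
    (run_le hD hβ (le_ciSup (Set.finite_range x0).bddAbove) t)
    (fun i => sum_weight_le hD (Nat.le_add_left 1 t) (run_xin_eq_xout t) i) i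

/-- Within an iteration the estimate is corrected against the old value; only then does the value
move, by at most the drift. -/
lemma isTrackingError_run (i j : Fin n) :
    IsTrackingError α (fun t => 1 / (2 * (t : ℝ) ^ β) * W x0) (fun t => Edge G t i j)
      (fun t => (run α β G D x0 t).x i - (run α β G D x0 t).xout i j) where
  drift t := by
    have h1 := newOut_error_le (G := G) (α := α) (s := run α β G D x0 t) (Nat.le_add_left 1 t) i j
    have h2 := abs_run_succ_sub_le (α := α) (x0 := x0) hD hβ t i
    have h3 := abs_sub_le ((run α β G D x0 (t + 1)).x i) ((run α β G D x0 t).x i)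
      ((run α β G D x0 (t + 1)).xout i j)
    change |(run α β G D x0 t).x i - (run α β G D x0 (t + 1)).xout i j| ≤ _ at h1
    linarith
  correct t he hs := by
    have h1 := newOut_error_eq (G := G) (α := α) (s := run α β G D x0 t) (Nat.le_add_left 1 t)
      he hs
    have h2 := abs_run_succ_sub_le (α := α) (x0 := x0) hD hβ t i
    have h3 := abs_sub_le ((run α β G D x0 (t + 1)).x i) ((run α β G D x0 t).x i)
      ((run α β G D x0 (t + 1)).xout i j)
    change |(run α β G D x0 t).x i - (run α β G D x0 (t + 1)).xout i j| = _ at h1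
    linarith

lemma abs_error_le (t : ℕ) (i j : Fin n) :
    |(run α β G D x0 t).x i - (run α β G D x0 t).xout i j| ≤ 2 * ‖x0‖ := by
  have h1 := abs_sub ((run α β G D x0 t).x i) ((run α β G D x0 t).xout i j)
  linarith [abs_run_le (α := α) (x0 := x0) hD hβ t i,
    abs_run_xout_le (α := α) (x0 := x0) hD hβ t i j]

end Run

/-! ### Contraction of the dispersion over a window -/

section Window

variable {n : ℕ} {α β : ℝ} {G : ℕ → SimpleGraph (Fin n)} {D : Fin n → Fin n → ℕ → ℝ}
  {x0 : Fin n → ℝ}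

/-- The nodes below and above a cut stay there as long as no edge across it is used. -/
lemma cut_persists (hD : IsDegreeBound G D) (hβ : 0 ≤ β) {S : Set (Fin n)} {lo hi : ℝ} {s u : ℕ}
    (hlo : ∀ i ∈ S, (run α β G D x0 s).x i ≤ lo) (hhi : ∀ i ∈ Sᶜ, hi ≤ (run α β G D x0 s).x i)
    (hsu : s ≤ u)
    (hno : ∀ v, s ≤ v → v < u → ∀ i ∈ S, ∀ j ∈ Sᶜ, runWeight α β G D x0 v i j = 0) :
    (∀ i ∈ S, (run α β G D x0 u).x i ≤ lo) ∧ ∀ i ∈ Sᶜ, hi ≤ (run α β G D x0 u).x i := by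
  induction u, hsu using Nat.le_induction with
  | base => exact ⟨hlo, hhi⟩
  | succ u hsu ih =>
    obtain ⟨h1, h2⟩ := ih fun v hv hvu => hno v hv (hvu.trans u.lt_succ_self)
    have h3 := hno u hsu u.lt_succ_self
    have hA := isAveraging_run (α := α) (x0 := x0) hD hβ u
    refine ⟨hA.le_of_closed h3 h1, hA.ge_of_closed (fun i hi j hj => ?_) h2⟩
    rw [hA.symm]
    exact h3 j (Set.notMem_compl_iff.1 hj) i hi

/-- The decrease of `V2` over a window of times in which each edge of a connected graph has a
time at which both of its nodes send the message `0`. -/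
lemma V2_sq_window (hD : IsDegreeBound G D) (hα : 0 ≤ α) (hβ : 0 ≤ β) {Dm : ℝ} (hDm : 0 < Dm)
    (hDD : ∀ t, 1 ≤ t → ∀ i j, Edge G t i j → D i j t ≤ Dm)
    {C : SimpleGraph (Fin n)} (hC : C.Connected) {s e : ℕ} (hs : 1 ≤ s)
    (hQ : ∀ i j, C.Adj i j → ∃ u, s ≤ u ∧ u < e ∧ Edge G (u + 1) i j ∧
      msg α (u + 1) (run α β G D x0 u) i j = 0 ∧ msg α (u + 1) (run α β G D x0 u) j i = 0)
    (hV : 3 * (n : ℝ) ^ (3 / 2 : ℝ) / (s : ℝ) ^ α < V2 (run α β G D x0 s).x) :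
    V2 (run α β G D x0 e).x ^ 2 ≤
      (1 - 2 * (1 / (3 * (n : ℝ) ^ 3 * Dm) / (e : ℝ) ^ β)) * V2 (run α β G D x0 s).x ^ 2 := by
  have hsα : 0 < (s : ℝ) ^ α := Real.rpow_pos_of_pos (by exact_mod_cast hs) α
  have hn3 : ((n : ℝ) ^ (3 / 2 : ℝ)) ^ 2 = (n : ℝ) ^ 3 := by
    rw [← Real.rpow_natCast, ← Real.rpow_mul (Nat.cast_nonneg n), ← Real.rpow_natCast]
    norm_num
  have hV0 : 0 < V2 (run α β G D x0 s).x := lt_of_le_of_lt (by positivity) hV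
  obtain ⟨S, lo, hi, ⟨p, hp⟩, ⟨q, hq⟩, hlo, hhi, hlt, hgap⟩ := exists_cut hV0
  have hn : (0 : ℝ) < n := by exact_mod_cast Fin.pos p
  -- The `3` in `hV` is half of the `6` required by `weight_ne_zero`, because of the `4` in `hgap`.
  have hbig : 6 / (s : ℝ) ^ α < hi - lo := by
    have h1 : (n : ℝ) ^ 3 * (6 / (s : ℝ) ^ α) ^ 2 < (n : ℝ) ^ 3 * (hi - lo) ^ 2 := by
      refine lt_of_lt_of_le ?_ hgap
      have h2 := pow_lt_pow_left₀ hV (by positivity) two_ne_zero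
      have h3 : (3 * (n : ℝ) ^ (3 / 2 : ℝ) / (s : ℝ) ^ α) ^ 2
          = (n : ℝ) ^ 3 * (6 / (s : ℝ) ^ α) ^ 2 / 4 := by
        rw [div_pow, mul_pow, hn3]
        ring
      linarith
    exact lt_of_pow_lt_pow_left₀ 2 (by linarith) (lt_of_mul_lt_mul_left h1 (by positivity))
  -- If no edge across the cut were used, the cut would persist; but a core edge crosses it, and at
  -- its quiet time the gap is large enough for it to be used.
  have hex : ∃ u, s ≤ u ∧ u < e ∧
      ∃ i ∈ S, ∃ j ∈ Sᶜ, runWeight α β G D x0 u i j ≠ 0 := by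
    by_contra! hno
    obtain ⟨w⟩ := hC.preconnected p q
    obtain ⟨d, -, hd1, hd2⟩ := w.exists_boundary_dart S hp hq
    obtain ⟨u, hsu, hue, he, hm1, hm2⟩ := hQ _ _ d.adj
    obtain ⟨h1, h2⟩ := cut_persists hD hβ hlo hhi hsu
      fun v hv hvu => hno v hv (hvu.trans hue)
    have h3 := h1 _ hd1
    have h4 := h2 _ hd2
    refine weight_ne_zero hD (Nat.le_add_left 1 u) (run_xin_eq_xout u) he hm1 hm2 ?_
      (hno u hsu hue _ hd1 _ hd2)
    refine lt_of_le_of_lt ?_ (lt_of_lt_of_le hbig (le_trans (by linarith) (le_abs_self _)))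
    have : (s : ℝ) ≤ ((u + 1 : ℕ) : ℝ) := by exact_mod_cast hsu.trans u.le_succ
    gcongr
  classical
  obtain ⟨hsu, hue, i, hi', j, hj', hw⟩ := Nat.find_spec hex
  -- Take the first such use: until then no value has left its side, so the endpoints are still at
  -- least `hi - lo` apart.
  set u := Nat.find hex with hu
  obtain ⟨h1, h2⟩ := cut_persists hD hβ hlo hhi hsu fun v hv hvu i hi j hj => by
    by_contra hne
    exact Nat.find_min hex hvu ⟨hv, hvu.trans hue, i, hi, j, hj, hne⟩
  have h3 := h1 i hi'
  have h4 := h2 j hj'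
  have h5 := (isAveraging_run (α := α) (x0 := x0) hD hβ u).V2_sq_le
    (p := i) (q := j) (fun h => hj' (h ▸ hi'))
  have h6 := weight_ge_of_ne_zero hD (Nat.le_add_left 1 u) (run_xin_eq_xout u) hw
    (hDD (u + 1) (Nat.le_add_left 1 u))
  have heβ : 0 < (e : ℝ) ^ β := Real.rpow_pos_of_pos (by exact_mod_cast by omega) β
  have h7 : 1 / (6 * Dm * (e : ℝ) ^ β) ≤ 1 / (6 * Dm * ((u + 1 : ℕ) : ℝ) ^ β) := by
    have h8 : ((u + 1 : ℕ) : ℝ) ≤ e := by exact_mod_cast hue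
    gcongr
  have h8 : V2 (run α β G D x0 e).x ^ 2 ≤ V2 (run α β G D x0 (u + 1)).x ^ 2 :=
    pow_le_pow_left₀ (V2_nonneg _) (V2_run_antitone hD hβ hue) 2
  have h9 : V2 (run α β G D x0 u).x ^ 2 ≤ V2 (run α β G D x0 s).x ^ 2 :=
    pow_le_pow_left₀ (V2_nonneg _) (V2_run_antitone hD hβ hsu) 2
  have h10 : (hi - lo) ^ 2 ≤ ((run α β G D x0 u).x i - (run α β G D x0 u).x j) ^ 2 := by
    nlinarith
  have h11 : 1 / (6 * Dm * (e : ℝ) ^ β) * (hi - lo) ^ 2 ≤ runWeight α β G D x0 u i j *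
      ((run α β G D x0 u).x i - (run α β G D x0 u).x j) ^ 2 :=
    mul_le_mul (h7.trans h6) h10 (sq_nonneg _) ((by positivity : (0 : ℝ) ≤ _).trans (h7.trans h6))
  have h12 : 2 * (1 / (3 * (n : ℝ) ^ 3 * Dm) / (e : ℝ) ^ β) * V2 (run α β G D x0 s).x ^ 2
      ≤ 1 / (6 * Dm * (e : ℝ) ^ β) * (hi - lo) ^ 2 := by
    calc _ = 1 / (6 * Dm * (e : ℝ) ^ β * (n : ℝ) ^ 3) * (4 * V2 (run α β G D x0 s).x ^ 2) := by
          field_simp; norm_num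
      _ ≤ 1 / (6 * Dm * (e : ℝ) ^ β * (n : ℝ) ^ 3) * ((n : ℝ) ^ 3 * (hi - lo) ^ 2) := by
          gcongr
      _ = _ := by field_simp
  linarith

/-- Square roots are taken through `1 - 2 * y ≤ (1 - y) ^ 2`, where `y ≤ 1`. -/
lemma V2_window (hD : IsDegreeBound G D) (hα : 0 ≤ α) (hβ : 0 ≤ β) {Dm : ℝ} (hDm : 1 ≤ Dm)
    (hDD : ∀ t, 1 ≤ t → ∀ i j, Edge G t i j → D i j t ≤ Dm)
    {C : SimpleGraph (Fin n)} (hC : C.Connected) {s e : ℕ} (hs : 1 ≤ s) (he : 1 ≤ e)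
    (hQ : ∀ i j, C.Adj i j → ∃ u, s ≤ u ∧ u < e ∧ Edge G (u + 1) i j ∧
      msg α (u + 1) (run α β G D x0 u) i j = 0 ∧ msg α (u + 1) (run α β G D x0 u) j i = 0)
    (hV : 3 * (n : ℝ) ^ (3 / 2 : ℝ) / (s : ℝ) ^ α < V2 (run α β G D x0 s).x) :
    V2 (run α β G D x0 e).x ≤
      (1 - 1 / (3 * (n : ℝ) ^ 3 * Dm) / (e : ℝ) ^ β) * V2 (run α β G D x0 s).x := by
  have h1 := V2_sq_window hD hα hβ (by linarith) hDD hC hs hQ hV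
  have hn : (1 : ℝ) ≤ n := by
    have := hC.nonempty
    exact_mod_cast Fin.pos (Classical.arbitrary (Fin n))
  have hn3 : (1 : ℝ) ≤ (n : ℝ) ^ 3 := one_le_pow₀ hn
  have heβ : 1 ≤ (e : ℝ) ^ β := Real.one_le_rpow (by exact_mod_cast he) hβ
  have h2 : 1 / (3 * (n : ℝ) ^ 3 * Dm) / (e : ℝ) ^ β ≤ 1 := by
    rw [div_div]
    refine div_le_one_of_le₀ ?_ (by positivity)
    calc (1 : ℝ) ≤ 3 * 1 * 1 * 1 := by norm_num
      _ ≤ _ := by gcongr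
  refine le_of_sq_le_sq ?_ (mul_nonneg (by linarith) (V2_nonneg _))
  refine h1.trans ?_
  rw [mul_pow]
  refine mul_le_mul_of_nonneg_right ?_ (sq_nonneg _)
  nlinarith [sq_nonneg (1 / (3 * (n : ℝ) ^ 3 * Dm) / (e : ℝ) ^ β)]

end Window

/-! ### From contraction over windows to a decay rate -/

section Decay

/-- A decreasing quantity which contracts by the factor `1 - κ / t ^ β` over each window of
length `L`, unless it is smaller than `r / t ^ α`. -/
lemma decay_grid {f : ℕ → ℝ} (hf : Antitone f) (hf0 : ∀ t, 0 ≤ f t) {α β κ r : ℝ} {L s : ℕ}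
    (hα1 : α ≤ 1) (hβ : 0 ≤ β) (hr : 0 ≤ r) (hL : 0 < L) (hs : 0 < s)
    (hκ : 0 ≤ κ) (hLs : L ≤ s) (hκs : 2 * L ≤ κ * (s : ℝ) ^ (1 - β)) (hβ1 : β ≤ 1)
    (hdec : ∀ k : ℕ, r / ((s + k * L : ℕ) : ℝ) ^ α < f (s + k * L) →
      f (s + (k + 1) * L) ≤ (1 - κ / ((s + (k + 1) * L : ℕ) : ℝ) ^ β) * f (s + k * L)) (k : ℕ) :
    f (s + k * L) ≤ max
      (f 0 * Real.exp (-(κ / L * (((s + (k + 1) * L : ℕ) : ℝ) ^ (1 - β)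
        - ((s + L : ℕ) : ℝ) ^ (1 - β)))))
      (2 * r / ((s + k * L : ℕ) : ℝ) ^ α) := by
  have hL' : (0 : ℝ) < L := by exact_mod_cast hL
  have hs' : (0 : ℝ) < s := by exact_mod_cast hs
  have hLs' : (L : ℝ) ≤ s := by exact_mod_cast hLs
  induction k with
  | zero =>
    refine le_max_of_le_left ?_
    simpa using hf (Nat.zero_le s)
  | succ k ih =>
    set u := ((s + k * L : ℕ) : ℝ) with hu
    set v := ((s + (k + 1) * L : ℕ) : ℝ) with hv
    set w := ((s + (k + 1 + 1) * L : ℕ) : ℝ) with hw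
    have huv : v = u + L := by rw [hu, hv]; push_cast; ring
    have hvw : w = v + L := by rw [hw, hv]; push_cast; ring
    have hsu : (s : ℝ) ≤ u := by rw [hu]; exact_mod_cast Nat.le_add_right _ _
    have hu0 : 0 < u := by linarith
    have hv0 : 0 < v := by linarith
    have hvβ : 0 < v ^ β := Real.rpow_pos_of_pos hv0 β
    have hvα : 0 < v ^ α := Real.rpow_pos_of_pos hv0 α
    have hα_uv : 1 / u ^ α ≤ v / u * (1 / v ^ α) := one_div_rpow_le hα1 hu0 (by linarith)
    have hvu : v / u ≤ 2 := by rw [div_le_iff₀ hu0]; linarith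
    rcases le_or_gt (f (s + k * L)) (r / u ^ α) with hsmall | hlarge
    · refine le_max_of_le_right ?_
      have h1 : f (s + (k + 1) * L) ≤ f (s + k * L) :=
        hf (by gcongr; omega)
      have h2 : v / u * (1 / v ^ α) ≤ 2 * (1 / v ^ α) := by gcongr
      calc f (s + (k + 1) * L) ≤ r * (1 / u ^ α) := by
            rw [mul_one_div]; exact h1.trans hsmall
        _ ≤ r * (2 * (1 / v ^ α)) := mul_le_mul_of_nonneg_left (hα_uv.trans h2) hr
        _ = 2 * r / v ^ α := by ring
    · have h1 := hdec k hlarge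
      have hexp : 1 - κ / v ^ β ≤ Real.exp (-(κ / v ^ β)) := by
        linarith [Real.add_one_le_exp (-(κ / v ^ β))]
      have h2 : f (s + (k + 1) * L) ≤ Real.exp (-(κ / v ^ β)) * f (s + k * L) :=
        h1.trans (mul_le_mul_of_nonneg_right hexp (hf0 _))
      rcases le_max_iff.1 ih with h3 | h3
      -- The exponents telescope: `L / v ^ β` bounds the growth of the power `1 - β` over the window
      -- following `v`.
      · refine le_max_of_le_left ?_
        have h4 := rpow_le_rpow_add (p := 1 - β) (by linarith) hv0 (y := w) (by linarith)
        have h5 : v ^ (1 - β - 1) = 1 / v ^ β := by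
          rw [show 1 - β - 1 = -β by ring, Real.rpow_neg hv0.le, one_div]
        rw [h5, hvw, add_sub_cancel_left, ← hvw] at h4
        have h6 : κ / L * (w ^ (1 - β) - v ^ (1 - β)) ≤ κ / v ^ β := by
          calc _ ≤ κ / L * (L * (1 / v ^ β)) := by gcongr; linarith
            _ = _ := by field_simp
        calc f (s + (k + 1) * L) ≤ Real.exp (-(κ / v ^ β)) * f (s + k * L) := h2
          _ ≤ Real.exp (-(κ / v ^ β)) * (f 0 * Real.exp (-(κ / L *
              (v ^ (1 - β) - ((s + L : ℕ) : ℝ) ^ (1 - β))))) := by gcongr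
          _ = f 0 * Real.exp (-(κ / v ^ β) + -(κ / L *
              (v ^ (1 - β) - ((s + L : ℕ) : ℝ) ^ (1 - β)))) := by rw [Real.exp_add]; ring
          _ ≤ _ := by
            refine mul_le_mul_of_nonneg_left (Real.exp_le_exp.2 ?_) (hf0 0)
            have h7 : κ / L * (w ^ (1 - β) - ((s + L : ℕ) : ℝ) ^ (1 - β))
                = κ / L * (w ^ (1 - β) - v ^ (1 - β))
                  + κ / L * (v ^ (1 - β) - ((s + L : ℕ) : ℝ) ^ (1 - β)) := by ring
            linarith
      -- By `hκs`, `κ / v ^ β ≥ 2 * L / v ≥ L / u`, so the contraction outweighs the factor `v / u`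
      -- by which `1 / u ^ α` may exceed `1 / v ^ α`.
      · refine le_max_of_le_right ?_
        have h4 : (s : ℝ) ^ (1 - β) ≤ v ^ (1 - β) :=
          Real.rpow_le_rpow hs'.le (by linarith) (by linarith)
        have h5 : v ^ (1 - β) = v / v ^ β := by rw [Real.rpow_sub hv0, Real.rpow_one]
        have h6 : 2 * L ≤ κ / v ^ β * v := by
          calc 2 * (L : ℝ) ≤ κ * (s : ℝ) ^ (1 - β) := hκs
            _ ≤ κ * (v / v ^ β) := by rw [← h5]; gcongr
            _ = _ := by ring
        have h7 : Real.exp (-(κ / v ^ β)) * (v / u) ≤ 1 := by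
          rw [Real.exp_neg, inv_mul_le_iff₀ (Real.exp_pos _), mul_one]
          refine le_trans ?_ (Real.add_one_le_exp _)
          rw [div_le_iff₀ hu0]
          have h8 : 0 ≤ κ / v ^ β := by positivity
          nlinarith
        calc f (s + (k + 1) * L) ≤ Real.exp (-(κ / v ^ β)) * f (s + k * L) := h2
          _ ≤ Real.exp (-(κ / v ^ β)) * (2 * r / u ^ α) := by gcongr
          _ = Real.exp (-(κ / v ^ β)) * (2 * r) * (1 / u ^ α) := by ring
          _ ≤ Real.exp (-(κ / v ^ β)) * (2 * r) * (v / u * (1 / v ^ α)) := by gcongr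
          _ = Real.exp (-(κ / v ^ β)) * (v / u) * (2 * r / v ^ α) := by ring
          _ ≤ 1 * (2 * r / v ^ α) := by gcongr
          _ = 2 * r / v ^ α := one_mul _

/-- The decay along the windows gives a bound at all later times. -/
lemma decay {f : ℕ → ℝ} (hf : Antitone f) (hf0 : ∀ t, 0 ≤ f t) {α β κ r : ℝ} {L s : ℕ}
    (hα1 : α ≤ 1) (hβ : 0 ≤ β) (hr : 0 ≤ r) (hL : 0 < L) (hs : 0 < s)
    (hκ : 0 ≤ κ) (hLs : 3 * L ≤ s) (hκs : 2 * L ≤ κ * (s : ℝ) ^ (1 - β)) (hβ1 : β ≤ 1)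
    (hdec : ∀ k : ℕ, r / ((s + k * L : ℕ) : ℝ) ^ α < f (s + k * L) →
      f (s + (k + 1) * L) ≤ (1 - κ / ((s + (k + 1) * L : ℕ) : ℝ) ^ β) * f (s + k * L))
    {t : ℕ} (ht : s ≤ t) :
    f t ≤ max
      (f 0 * Real.exp (-(κ / L * ((t : ℝ) ^ (1 - β) - ((s + L : ℕ) : ℝ) ^ (1 - β)))))
      (8 / 3 * r / (t : ℝ) ^ α) := by
  set k := (t - s) / L with hk
  have h1 : k * L ≤ t - s := Nat.div_mul_le_self _ _
  have h2 : t - s < (k + 1) * L := by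
    rw [mul_comm]; exact Nat.lt_mul_div_succ _ hL
  have hst : s + k * L ≤ t := by omega
  have hts : t ≤ s + (k + 1) * L := by omega
  have hL' : (0 : ℝ) < L := by exact_mod_cast hL
  have hu0 : (0 : ℝ) < ((s + k * L : ℕ) : ℝ) := by exact_mod_cast by omega
  have hgrid := decay_grid hf hf0 hα1 hβ hr hL hs hκ (by omega) hκs hβ1 hdec k
  refine (hf hst).trans (hgrid.trans (max_le_max ?_ ?_))
  · refine mul_le_mul_of_nonneg_left (Real.exp_le_exp.2 (neg_le_neg ?_)) (hf0 0)
    have : (t : ℝ) ≤ ((s + (k + 1) * L : ℕ) : ℝ) := by exact_mod_cast hts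
    gcongr
  · have h3 := one_div_rpow_le hα1 hu0 (y := (t : ℝ)) (by exact_mod_cast hst)
    -- Since `3 * L ≤ s`, leaving the grid costs only `4 / 3`. With `r = 3 * n ^ (3 / 2)` this
    -- yields the `8` of the theorem.
    have h4 : (t : ℝ) / ((s + k * L : ℕ) : ℝ) ≤ 4 / 3 := by
      rw [div_le_iff₀ hu0]
      have h5 : (t : ℝ) ≤ ((s + k * L : ℕ) : ℝ) + L := by
        have e : s + (k + 1) * L = s + k * L + L := by ring
        exact_mod_cast e ▸ hts
      have h6 : 3 * (L : ℝ) ≤ ((s + k * L : ℕ) : ℝ) := by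
        exact_mod_cast hLs.trans (Nat.le_add_right _ _)
      linarith
    have h5 : 0 ≤ 1 / (t : ℝ) ^ α := by positivity
    calc 2 * r / ((s + k * L : ℕ) : ℝ) ^ α = 2 * r * (1 / ((s + k * L : ℕ) : ℝ) ^ α) := by ring
      _ ≤ 2 * r * (4 / 3 * (1 / (t : ℝ) ^ α)) :=
        mul_le_mul_of_nonneg_left (h3.trans (mul_le_mul_of_nonneg_right h4 h5)) (by linarith)
      _ = _ := by ring

end Decay

/-! ### Explicit waiting times -/

lemma rpow_add_half_le {p U X t : ℝ} (hp : 0 < p) (hU : 0 ≤ U) (hX : 0 ≤ X)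
    (ht : (2 : ℝ) ^ (1 / p) * U + X ≤ t) : U ^ p + X ^ p / 2 ≤ t ^ p := by
  have h2 : ((2 : ℝ) ^ (1 / p)) ^ p = 2 := by
    rw [← Real.rpow_mul two_pos.le, one_div_mul_cancel hp.ne', Real.rpow_one]
  have h0 : (0 : ℝ) ≤ (2 : ℝ) ^ (1 / p) := by positivity
  -- The claim is the average of `2 * U ^ p ≤ t ^ p` and `X ^ p ≤ t ^ p`.
  have h3 : ((2 : ℝ) ^ (1 / p) * U) ^ p ≤ t ^ p :=
    Real.rpow_le_rpow (by positivity) (by linarith) hp.le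
  have h4 : X ^ p ≤ t ^ p :=
    Real.rpow_le_rpow hX (by linarith [mul_nonneg h0 hU]) hp.le
  rw [Real.mul_rpow h0 hU, h2] at h3
  linarith

/-- The drift is `1 / t ^ α / (16 * B)` times `8 * B * w / t ^ (β - α)`, hence the exponent `1 / (β
- α)`. -/
lemma slowDrift_of_le {α β w M : ℝ} {B s : ℕ} (hαβ : α < β) (hB : 0 < B) (hw : 0 ≤ w)
    (hM : 32 * (B : ℝ) + 8 * B * w ≤ M) (hs : M ^ (1 / (β - α)) ≤ s) :
    SlowDrift α (fun t => 1 / (2 * (t : ℝ) ^ β) * w) B s := by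
  intro t ht
  have hB' : (0 : ℝ) < B := by exact_mod_cast hB
  have hBw : 0 ≤ (B : ℝ) * w := by positivity
  have hM0 : 0 < M := by nlinarith
  have hA : M ^ (1 / (β - α)) ≤ t := hs.trans (by exact_mod_cast ht)
  have ht0 : (0 : ℝ) < t := lt_of_lt_of_le (Real.rpow_pos_of_pos hM0 _) hA
  have h1 : M ≤ (t : ℝ) ^ (β - α) := by
    have h2 := Real.rpow_le_rpow (by positivity) hA (sub_pos.2 hαβ).le
    rwa [← Real.rpow_mul hM0.le, one_div_mul_cancel (sub_pos.2 hαβ).ne', Real.rpow_one] at h2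
  have h3 : (t : ℝ) ^ β = (t : ℝ) ^ α * (t : ℝ) ^ (β - α) := by
    rw [← Real.rpow_add ht0]; congr 1; ring
  have hα0 : 0 < (t : ℝ) ^ α := Real.rpow_pos_of_pos ht0 α
  have hτ : 0 < (t : ℝ) ^ (β - α) := Real.rpow_pos_of_pos ht0 _
  have h4 : 8 * B * w / (t : ℝ) ^ (β - α) ≤ 1 := by
    rw [div_le_one hτ]; nlinarith
  calc 1 / (2 * (t : ℝ) ^ β) * w
      = 1 / (t : ℝ) ^ α / (16 * B) * (8 * B * w / (t : ℝ) ^ (β - α)) := by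
        rw [h3]; field_simp; ring
    _ ≤ 1 / (t : ℝ) ^ α / (16 * B) * 1 := by gcongr
    _ = _ := mul_one _

/-- This is the purpose of the summand `32 * B`: block indices are at least `32`, as `block_le`
requires. -/
lemma le_rpow_of_slow {α β w M : ℝ} {B : ℕ} (hα : 0 < α) (hαβ : α < β) (hβ : β < 1) (hB : 0 < B)
    (hw : 0 ≤ w) (hM : 32 * (B : ℝ) + 8 * B * w ≤ M) : 32 * (B : ℝ) ≤ M ^ (1 / (β - α)) := by
  have hB' : (1 : ℝ) ≤ B := by exact_mod_cast hB
  have hBw : 0 ≤ (B : ℝ) * w := by positivity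
  have h1 : 1 ≤ 1 / (β - α) := (one_le_div (by linarith)).2 (by linarith)
  have h2 := Real.rpow_le_rpow_of_exponent_le (x := M) (by nlinarith) h1
  rw [Real.rpow_one] at h2
  nlinarith

lemma four_le_two_rpow {α : ℝ} (hα : 0 < α) (hα1 : α < 1) : (4 : ℝ) ≤ 2 ^ (2 / (1 - α)) := by
  have h1 : (2 : ℝ) ≤ 2 / (1 - α) := by
    rw [le_div_iff₀ (by linarith)]; linarith
  have h2 := Real.rpow_le_rpow_of_exponent_le (x := (2 : ℝ)) one_le_two h1
  rw [Real.rpow_two] at h2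
  linarith

/-- The time by which the estimates track the values. -/
lemma tracked_of_long {α β w M c : ℝ} {P : ℕ → Prop} {h : ℕ → ℝ} {B K : ℕ}
    (H : IsTrackingError α (fun t => 1 / (2 * (t : ℝ) ^ β) * w) P h)
    (hα : 0 < α) (hαβ : α < β) (hβ : β < 1) (hB : 0 < B) (hw : 0 ≤ w)
    (hP : ∀ k : ℕ, ∃ t ∈ Finset.Icc (k * B + 1) ((k + 1) * B), P t)
    (hc : ∀ t, |h t| ≤ 2 * c) (hM : 32 * (B : ℝ) + 8 * B * w ≤ M)
    (hK : (2 : ℝ) ^ (2 / (1 - α)) * M ^ (1 / (β - α)) + (32 * (B : ℝ) * c) ^ (2 / (1 - α))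
      ≤ ((K * B : ℕ) : ℝ)) :
    |h (K * B)| ≤ 9 / 8 * (1 / ((K * B : ℕ) : ℝ) ^ α) := by
  have hB' : (1 : ℝ) ≤ B := by exact_mod_cast hB
  have hc0 : 0 ≤ c := by linarith [hc 0, abs_nonneg (h 0)]
  have hp : 0 < 1 - α := by linarith
  have hAB := le_rpow_of_slow hα hαβ hβ hB hw hM
  set A := M ^ (1 / (β - α)) with hA
  have hA1 : 1 ≤ A := by linarith
  have hA0 : 0 < A := by linarith
  set Y := 32 * (B : ℝ) * c with hY
  have hY0 : 0 ≤ Y := by positivity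
  have hYp : 0 ≤ Y ^ (2 / (1 - α)) := Real.rpow_nonneg hY0 _
  have h4 := four_le_two_rpow hα (by linarith : α < 1)
  have h4A : 4 * A ≤ ((K * B : ℕ) : ℝ) := by nlinarith
  -- Block `k₀` is the first to start once the drift is slow.
  obtain ⟨k₀, hk1, hk2⟩ : ∃ k₀ : ℕ, A ≤ k₀ * B ∧ (k₀ : ℝ) * B ≤ A + B := by
    refine ⟨⌈A / B⌉₊, ?_, ?_⟩
    · rw [← div_le_iff₀ (by linarith)]; exact Nat.le_ceil _
    · have h5 := (Nat.ceil_lt_add_one (by positivity : 0 ≤ A / B)).le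
      calc (⌈A / B⌉₊ : ℝ) * B ≤ (A / B + 1) * B := by gcongr
        _ = A + B := by field_simp
  have hk32 : 32 ≤ k₀ := by
    have : (32 : ℝ) ≤ k₀ := le_of_mul_le_mul_right (hAB.trans hk1) (by linarith)
    exact_mod_cast this
  have hkK : k₀ ≤ K := by
    have : (k₀ : ℝ) ≤ K := by
      refine le_of_mul_le_mul_right (a := (B : ℝ)) ?_ (by linarith)
      push_cast at h4A
      linarith
    exact_mod_cast this
  refine H.exists_tracked hα (by linarith) hB hk32 hkK
    (slowDrift_of_le hαβ hB hw hM (by exact_mod_cast hk1)) hP (hc _) ?_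
  have hAp : 1 ≤ A ^ (1 - α) := Real.one_le_rpow hA1 hp.le
  have e1 : ((2 : ℝ) ^ (2 / (1 - α)) * A) ^ (1 - α) = 4 * A ^ (1 - α) := by
    rw [Real.mul_rpow (by positivity) hA0.le, ← Real.rpow_mul two_pos.le,
      div_mul_cancel₀ _ hp.ne', Real.rpow_two]
    norm_num
  have e2 : (Y ^ (2 / (1 - α))) ^ (1 - α) = Y ^ 2 := by
    rw [← Real.rpow_mul hY0, div_mul_cancel₀ _ hp.ne', Real.rpow_two]
  have hK1 : ((K * B : ℕ) : ℝ) ≤ (((K + 1) * B : ℕ) : ℝ) := by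
    exact_mod_cast Nat.mul_le_mul_right B K.le_succ
  have g1 : 4 * A ^ (1 - α) ≤ (((K + 1) * B : ℕ) : ℝ) ^ (1 - α) := by
    rw [← e1]
    exact Real.rpow_le_rpow (by positivity) (by linarith) hp.le
  have g2 : Y ^ 2 ≤ (((K + 1) * B : ℕ) : ℝ) ^ (1 - α) := by
    rw [← e2]
    exact Real.rpow_le_rpow hYp (by nlinarith) hp.le
  have g3 : (((k₀ + 1) * B : ℕ) : ℝ) ^ (1 - α) ≤ 17 / 16 * A ^ (1 - α) := by
    have h5 := rpow_le_rpow_add (p := 1 - α) (by linarith) hA0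
      (y := (((k₀ + 1) * B : ℕ) : ℝ)) (by push_cast; linarith)
    refine h5.trans ?_
    rw [Real.rpow_sub_one hA0.ne']
    have h6 : ((((k₀ + 1) * B : ℕ) : ℝ) - A) / A ≤ 1 / 16 := by
      rw [div_le_iff₀ hA0]; push_cast; linarith
    calc _ = A ^ (1 - α) + ((((k₀ + 1) * B : ℕ) : ℝ) - A) / A * A ^ (1 - α) := by ring
      _ ≤ A ^ (1 - α) + 1 / 16 * A ^ (1 - α) := by gcongr
      _ = _ := by ring
  have e3 : 8 / 7 * ((B : ℝ) * (2 * c)) = Y / 14 := by rw [hY]; ring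
  rw [e3]
  -- The average of `g1` and `g2`, minus `g3`, leaves at least `15 / 16 * A ^ (1 - α) + Y ^ 2 / 2`,
  -- more than `Y / 14`.
  nlinarith [sq_nonneg (Y - 1)]

lemma mul_exp_neg_le {v ε y : ℝ} (hv : 0 ≤ v) (hε : 0 < ε) (hy : Real.posLog (v / ε) ≤ y) :
    v * Real.exp (-y) ≤ ε := by
  rcases hv.eq_or_lt with rfl | h0
  · rw [zero_mul]; exact hε.le
  · have h1 : Real.log (v / ε) ≤ y := (le_max_right _ _).trans hy
    have h2 : v / ε ≤ Real.exp y := by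
      rw [← Real.exp_log (div_pos h0 hε)]
      exact Real.exp_le_exp.2 h1
    rw [div_le_iff₀ hε] at h2
    calc v * Real.exp (-y) ≤ Real.exp y * ε * Real.exp (-y) := by gcongr
      _ = ε * (Real.exp y * Real.exp (-y)) := by ring
      _ = ε := by rw [← Real.exp_add, add_neg_cancel, Real.exp_zero, mul_one]

/-! ### The time bound and the limit -/

section Main

variable {n B : ℕ} {α β : ℝ} {G : ℕ → SimpleGraph (Fin n)} {D : Fin n → Fin n → ℕ → ℝ}
  {x0 : Fin n → ℝ}

lemma W_nonneg [Nonempty (Fin n)] (x : Fin n → ℝ) : 0 ≤ W x :=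
  sub_nonneg.2 (ciInf_le_ciSup (Set.finite_range x).bddBelow (Set.finite_range x).bddAbove)

/-- From some time on, any three blocks of times contain one at which an edge of the core is
present and both of its nodes send the message `0`. -/
lemma exists_quiet_run (hα : 0 < α) (hαβ : α < β) (hβ : β < 1) (hD : IsDegreeBound G D)
    (hB : 0 < B) {i j : Fin n}
    (hij : ∀ k : ℕ, ∃ t ∈ Finset.Icc (k * B + 1) ((k + 1) * B), (G t).Adj i j)
    {M : ℝ} (hM : 32 * (B : ℝ) + 8 * B * W x0 ≤ M) {K : ℕ}
    (hK : (2 : ℝ) ^ (2 / (1 - α)) * M ^ (1 / (β - α)) + (32 * (B : ℝ) * ‖x0‖) ^ (2 / (1 - α))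
      ≤ ((K * B : ℕ) : ℝ)) :
    ∃ u, K * B ≤ u ∧ u < (K + 3) * B ∧ Edge G (u + 1) i j ∧
      msg α (u + 1) (run α β G D x0 u) i j = 0 ∧ msg α (u + 1) (run α β G D x0 u) j i = 0 := by
  have : Nonempty (Fin n) := ⟨i⟩
  have hW := W_nonneg x0
  have hβ0 : 0 ≤ β := by linarith
  have H₁ := isTrackingError_run (α := α) (x0 := x0) hD hβ0 i j
  have H₂ := isTrackingError_run (α := α) (x0 := x0) hD hβ0 j i
  rw [show (fun t => Edge G t j i) = fun t => Edge G t i j from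
    funext fun t => propext ⟨Edge.symm, Edge.symm⟩] at H₂
  have hP : ∀ k : ℕ, ∃ t ∈ Finset.Icc (k * B + 1) ((k + 1) * B), Edge G t i j := fun k =>
    (hij k).imp fun t ht => ⟨ht.1, Or.inr ht.2⟩
  have T₁ := tracked_of_long H₁ hα hαβ hβ hB hW hP
    (fun t => abs_error_le hD hβ0 t i j) hM hK
  have T₂ := tracked_of_long H₂ hα hαβ hβ hB hW hP
    (fun t => abs_error_le hD hβ0 t j i) hM hK
  have hB' : (0 : ℝ) < B := by exact_mod_cast hB
  have hA := le_rpow_of_slow hα hαβ hβ hB hW hM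
  have h4 := four_le_two_rpow hα (by linarith : α < 1)
  have hY : 0 ≤ (32 * (B : ℝ) * ‖x0‖) ^ (2 / (1 - α)) := by positivity
  have hAK : M ^ (1 / (β - α)) ≤ ((K * B : ℕ) : ℝ) := by nlinarith
  have hK32 : 32 ≤ K := by
    have h5 : 32 * (B : ℝ) ≤ K * B := by push_cast at hAK; linarith
    exact_mod_cast le_of_mul_le_mul_right h5 hB'
  obtain ⟨u, h1, h2, h3, h5, h6⟩ := H₁.exists_quiet H₂ hα (by linarith) hB hK32
    (slowDrift_of_le hαβ hB hW hM hAK) hP T₁ T₂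
  exact ⟨u, h1, h2, h3, (msg_eq_zero_iff (Nat.le_add_left 1 u)).2 h5,
    (msg_eq_zero_iff (Nat.le_add_left 1 u)).2 h6⟩

lemma le_sSup_degreeBounds (hDb : BddAbove (degreeBounds G D)) (t : ℕ) (ht : 1 ≤ t)
    (i j : Fin n) (h : Edge G t i j) : D i j t ≤ sSup (degreeBounds G D) :=
  le_csSup hDb ⟨t, ht, i, j, h, rfl⟩

set_option maxHeartbeats 1000000 in
/-- The time by which `V2` is at most `ε`. -/
theorem V2_run_le (hn : 2 ≤ n) (hα : 0 < α) (hαβ : α < β) (hβ : β < 1)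
    (hG : IsCoreConnected B G) (hD : IsDegreeBound G D) (hDb : BddAbove (degreeBounds G D))
    {M : ℝ} (hM : 32 * (B : ℝ) + 8 * B * W x0 ≤ M) {ε : ℝ} (hε : 0 < ε) {t : ℕ}
    (ht : (2 : ℝ) ^ (1 / (1 - β)) *
          ((2 : ℝ) ^ (2 / (1 - α)) * M ^ (1 / (β - α))
            + (32 * (B : ℝ) * ‖x0‖) ^ (2 / (1 - α))
            + 11 * (B : ℝ)
            + (300 * (n : ℝ) ^ 3 * sSup (degreeBounds G D) * (B : ℝ)) ^ (1 / (1 - β)))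
        + max
          ((150 * (n : ℝ) ^ 3 * sSup (degreeBounds G D) * (B : ℝ)
              * Real.posLog (V2 x0 / ε)) ^ (1 / (1 - β)))
          ((8 * (n : ℝ) ^ (3 / 2 : ℝ) / ε) ^ (1 / α)) ≤ (t : ℝ)) :
    V2 (run α β G D x0 t).x ≤ ε := by
  obtain ⟨C, -, hC, hCB⟩ := hG
  have : Nonempty (Fin n) := hC.nonempty
  have : Nontrivial (Fin n) := Fin.nontrivial_iff_two_le.2 hn
  -- With two nodes the core has an edge, which could not appear in the empty blocks of `B = 0`.
  have hB : 0 < B := by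
    obtain ⟨p, q, hpq⟩ := exists_pair_ne (Fin n)
    obtain ⟨w⟩ := hC.preconnected p q
    obtain ⟨d, -, -, -⟩ := w.exists_boundary_dart {p} rfl (fun h => hpq h.symm)
    obtain ⟨s, hs, -⟩ := hCB 0 _ _ d.adj
    rw [Finset.mem_Icc] at hs
    omega
  have hB' : (1 : ℝ) ≤ B := by exact_mod_cast hB
  have hW := W_nonneg x0
  have hn' : (1 : ℝ) ≤ n := by exact_mod_cast (by omega : 1 ≤ n)
  have hn3 : (1 : ℝ) ≤ (n : ℝ) ^ 3 := one_le_pow₀ hn'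
  have hDD := le_sSup_degreeBounds hDb
  set Dm := sSup (degreeBounds G D) with hDm'
  have hDm : 1 ≤ Dm := by
    obtain ⟨i⟩ := this.to_nonempty
    have he : Edge G 1 i i := Or.inl rfl
    exact (one_le_D hD le_rfl he).trans (hDD 1 le_rfl i i he)
  have hp : 0 < 1 - β := by linarith
  have hα1 : α < 1 := by linarith
  have hβ0 : 0 ≤ β := by linarith
  set T := (2 : ℝ) ^ (2 / (1 - α)) * M ^ (1 / (β - α))
    + (32 * (B : ℝ) * ‖x0‖) ^ (2 / (1 - α)) with hT
  set E := 300 * (n : ℝ) ^ 3 * Dm * (B : ℝ) with hE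
  have hE300 : 300 * (B : ℝ) ≤ E := by
    calc 300 * (B : ℝ) = 300 * 1 * 1 * B := by ring
      _ ≤ _ := by rw [hE]; gcongr
  have hE0 : 0 ≤ E := by linarith
  set Z := E ^ (1 / (1 - β)) with hZ
  have hEZ : E ≤ Z := by
    have h1 : 1 ≤ 1 / (1 - β) := (one_le_div hp).2 (by linarith)
    have h2 := Real.rpow_le_rpow_of_exponent_le (x := E) (by linarith) h1
    rwa [Real.rpow_one] at h2
  have hT0 : 0 ≤ T := by
    have : 0 ≤ M := by nlinarith
    positivity
  -- Past `T` the estimates track the values; past `Z` the contraction beats `1 / t ^ α`. The `11 *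
  -- B` in `U` amply covers rounding and one window of length `3 * B`.
  obtain ⟨K, hK1, hK2⟩ : ∃ K : ℕ, T + Z ≤ K * B ∧ (K : ℝ) * B ≤ T + Z + B := by
    refine ⟨⌈(T + Z) / B⌉₊, ?_, ?_⟩
    · rw [← div_le_iff₀ (by linarith)]; exact Nat.le_ceil _
    · have h5 := (Nat.ceil_lt_add_one (a := (T + Z) / B)
        (div_nonneg (by linarith) (by linarith))).le
      calc (⌈(T + Z) / B⌉₊ : ℝ) * B ≤ ((T + Z) / B + 1) * B := by gcongr
        _ = T + Z + B := by field_simp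
  set U := T + 11 * (B : ℝ) + Z with hU
  set l := Real.posLog (V2 x0 / ε) with hl
  have hl0 : 0 ≤ l := Real.posLog_nonneg
  set X := max ((150 * (n : ℝ) ^ 3 * Dm * (B : ℝ) * l) ^ (1 / (1 - β)))
    ((8 * (n : ℝ) ^ (3 / 2 : ℝ) / ε) ^ (1 / α)) with hX
  have hX0 : 0 ≤ X := le_max_of_le_right (by positivity)
  have hU0 : 0 ≤ U := by linarith
  have hpow := rpow_add_half_le hp hU0 hX0 ht
  have h2p : (1 : ℝ) ≤ 2 ^ (1 / (1 - β)) := Real.one_le_rpow one_le_two (by positivity)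
  have hUt : U ≤ t := by nlinarith
  have hXt : X ≤ t := by nlinarith
  have hKt : K * B ≤ t := by
    have : (K : ℝ) * B ≤ t := by linarith
    exact_mod_cast this
  have hK300 : 9 ≤ K := by
    have h1 : (9 : ℝ) * B ≤ K * B := by linarith
    exact_mod_cast le_of_mul_le_mul_right h1 (by linarith : (0 : ℝ) < B)
  set κ := 1 / (3 * (n : ℝ) ^ 3 * Dm) with hκ
  have hκ0 : 0 ≤ κ := by positivity
  have hκE : κ * E = 100 * B := by
    rw [hκ, hE]; field_simp; norm_num
  have hmain := decay (f := fun t => V2 (run α β G D x0 t).x) (V2_run_antitone hD hβ0)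
    (fun _ => V2_nonneg _) (α := α) (β := β) (κ := κ) (r := 3 * (n : ℝ) ^ (3 / 2 : ℝ))
    (L := 3 * B) (s := K * B) hα1.le hβ0 (by positivity) (by omega)
    (Nat.mul_pos (by omega) hB) hκ0 (by nlinarith) ?_ hβ.le ?_ hKt
  · refine hmain.trans (max_le ?_ ?_)
    · have hZU : (((K * B + 3 * B : ℕ)) : ℝ) ^ (1 - β) ≤ U ^ (1 - β) := by
        refine Real.rpow_le_rpow (Nat.cast_nonneg _) ?_ hp.le
        push_cast
        linarith
      have hXp : 150 * (n : ℝ) ^ 3 * Dm * (B : ℝ) * l ≤ X ^ (1 - β) := by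
        have h0 : 0 ≤ 150 * (n : ℝ) ^ 3 * Dm * (B : ℝ) * l := by positivity
        have h1 := Real.rpow_le_rpow (by positivity) (le_max_left _ _ : _ ≤ X) hp.le
        rwa [← Real.rpow_mul h0, one_div_mul_cancel hp.ne', Real.rpow_one] at h1
      -- The `150` is halved to `75` by `rpow_add_half_le`, and the factor `κ / (3 * B)` leaves `75
      -- / 9 * l ≥ l`.
      have hlog : l ≤ κ / ((3 * B : ℕ) : ℝ) *
          ((t : ℝ) ^ (1 - β) - ((K * B + 3 * B : ℕ) : ℝ) ^ (1 - β)) := by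
        have h1 : 75 * (n : ℝ) ^ 3 * Dm * (B : ℝ) * l ≤
            (t : ℝ) ^ (1 - β) - ((K * B + 3 * B : ℕ) : ℝ) ^ (1 - β) := by linarith
        refine le_trans ?_ (mul_le_mul_of_nonneg_left h1 (by positivity))
        have h2 : κ / ((3 * B : ℕ) : ℝ) * (75 * (n : ℝ) ^ 3 * Dm * (B : ℝ) * l) = 75 / 9 * l := by
          rw [hκ]; push_cast; field_simp; ring
        rw [h2]
        linarith
      exact mul_exp_neg_le (V2_nonneg x0) hε hlog
    · have h0 : 0 ≤ 8 * (n : ℝ) ^ (3 / 2 : ℝ) / ε := by positivity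
      have ht0 : (0 : ℝ) < t := by linarith
      have h1 := Real.rpow_le_rpow (by positivity) ((le_max_right _ _ : _ ≤ X).trans hXt) hα.le
      rw [← Real.rpow_mul h0, one_div_mul_cancel hα.ne', Real.rpow_one, div_le_iff₀ hε] at h1
      rw [div_le_iff₀ (Real.rpow_pos_of_pos ht0 α)]
      linarith
  · have h1 : E ≤ ((K * B : ℕ) : ℝ) ^ (1 - β) := by
      have h2 : Z ≤ ((K * B : ℕ) : ℝ) := by push_cast; linarith
      have h3 := Real.rpow_le_rpow (by positivity) h2 hp.le
      rwa [hZ, ← Real.rpow_mul hE0, one_div_mul_cancel hp.ne', Real.rpow_one] at h3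
    have h2 := mul_le_mul_of_nonneg_left h1 hκ0
    rw [hκE] at h2
    push_cast at h2 ⊢
    linarith
  · intro k hk
    have e1 : K * B + k * (3 * B) = (K + 3 * k) * B := by ring
    have e2 : K * B + (k + 1) * (3 * B) = (K + 3 * k + 3) * B := by ring
    refine V2_window hD hα.le hβ0 hDm hDD hC (by nlinarith) (by nlinarith) ?_ hk
    intro i j hij
    rw [e1, e2]
    refine exists_quiet_run hα hαβ hβ hD hB (fun k => hCB k i j hij) hM ?_
    have h3 : ((K : ℝ)) * B ≤ (((K + 3 * k) * B : ℕ) : ℝ) := by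
      exact_mod_cast Nat.mul_le_mul_right B (Nat.le_add_right K (3 * k))
    linarith

end Main

end TernaryConsensus

theorem theorem2p3 (n B : ℕ) (α β : ℝ) (hα : 0 < α) (hαβ : α < β) (hβ : β < 1)
    (G : ℕ → SimpleGraph (Fin n)) (hG : TernaryConsensus.IsCoreConnected B G)
    (D : Fin n → Fin n → ℕ → ℝ) (hD : TernaryConsensus.IsDegreeBound G D)
    (hDb : BddAbove (TernaryConsensus.degreeBounds G D))
    (x0 : Fin n → ℝ) :
    (∀ i : Fin n,
      Tendsto (fun t : ℕ => (TernaryConsensus.run α β G D x0 t).x i) atTop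
        (𝓝 (1 / (n : ℝ) * ∑ j, x0 j))) ∧
    ∀ ε : ℝ, 0 < ε → ∀ t : ℕ,
      (2 : ℝ) ^ (1 / (1 - β)) *
          ((2 : ℝ) ^ (2 / (1 - α)) *
              ((⌈32 * (B : ℝ) + 8 * (B : ℝ) * TernaryConsensus.W x0⌉ : ℤ) : ℝ) ^ (1 / (β - α))
            + (32 * (B : ℝ) * ‖x0‖) ^ (2 / (1 - α))
            + 11 * (B : ℝ)
            + (300 * (n : ℝ) ^ 3 * sSup (TernaryConsensus.degreeBounds G D) * (B : ℝ))
                ^ (1 / (1 - β)))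
        + max
          ((150 * (n : ℝ) ^ 3 * sSup (TernaryConsensus.degreeBounds G D) * (B : ℝ)
              * Real.posLog (TernaryConsensus.V2 x0 / ε)) ^ (1 / (1 - β)))
          ((8 * (n : ℝ) ^ (3 / 2 : ℝ) / ε) ^ (1 / α)) ≤ (t : ℝ) →
      TernaryConsensus.V2 (TernaryConsensus.run α β G D x0 t).x ≤ ε := by
  have hC : ∃ C : SimpleGraph (Fin n), C.Connected := hG.imp fun C h => h.2.1
  obtain ⟨C, hC⟩ := hC
  have hne : Nonempty (Fin n) := hC.nonempty
  have hn : 1 ≤ n := Fin.pos hne.some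
  have hβ0 : 0 ≤ β := by linarith
  have hquant : ∀ ε : ℝ, 0 < ε → ∀ t : ℕ,
      (2 : ℝ) ^ (1 / (1 - β)) *
          ((2 : ℝ) ^ (2 / (1 - α)) *
              ((⌈32 * (B : ℝ) + 8 * (B : ℝ) * TernaryConsensus.W x0⌉ : ℤ) : ℝ) ^ (1 / (β - α))
            + (32 * (B : ℝ) * ‖x0‖) ^ (2 / (1 - α))
            + 11 * (B : ℝ)
            + (300 * (n : ℝ) ^ 3 * sSup (TernaryConsensus.degreeBounds G D) * (B : ℝ))
                ^ (1 / (1 - β)))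
        + max
          ((150 * (n : ℝ) ^ 3 * sSup (TernaryConsensus.degreeBounds G D) * (B : ℝ)
              * Real.posLog (TernaryConsensus.V2 x0 / ε)) ^ (1 / (1 - β)))
          ((8 * (n : ℝ) ^ (3 / 2 : ℝ) / ε) ^ (1 / α)) ≤ (t : ℝ) →
      TernaryConsensus.V2 (TernaryConsensus.run α β G D x0 t).x ≤ ε := by
    intro ε hε t ht
    -- A single node has `V2 = 0`; the general bound needs an edge in the core.
    rcases hn.eq_or_lt with rfl | hn2
    · simp [TernaryConsensus.V2, hε.le]
    · exact TernaryConsensus.V2_run_le hn2 hα hαβ hβ hG hD hDb (Int.le_ceil _) hε ht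
  refine ⟨fun i => ?_, hquant⟩
  rw [Metric.tendsto_atTop']
  intro ε hε
  have hlarge := tendsto_natCast_atTop_atTop (R := ℝ) |>.eventually_ge_atTop
    ((2 : ℝ) ^ (1 / (1 - β)) *
          ((2 : ℝ) ^ (2 / (1 - α)) *
              ((⌈32 * (B : ℝ) + 8 * (B : ℝ) * TernaryConsensus.W x0⌉ : ℤ) : ℝ) ^ (1 / (β - α))
            + (32 * (B : ℝ) * ‖x0‖) ^ (2 / (1 - α))
            + 11 * (B : ℝ)
            + (300 * (n : ℝ) ^ 3 * sSup (TernaryConsensus.degreeBounds G D) * (B : ℝ))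
                ^ (1 / (1 - β)))
        + max
          ((150 * (n : ℝ) ^ 3 * sSup (TernaryConsensus.degreeBounds G D) * (B : ℝ)
              * Real.posLog (TernaryConsensus.V2 x0 / (ε / 2))) ^ (1 / (1 - β)))
          ((8 * (n : ℝ) ^ (3 / 2 : ℝ) / (ε / 2)) ^ (1 / α)))
  obtain ⟨N, hN⟩ := eventually_atTop.1 hlarge
  refine ⟨N, fun t ht => ?_⟩
  have h1 := hquant (ε / 2) (half_pos hε) t (hN t ht.le)
  have h2 := TernaryConsensus.abs_sub_average_le_V2 (TernaryConsensus.run α β G D x0 t).x i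
  rw [TernaryConsensus.sum_run hD hβ0] at h2
  rw [Real.dist_eq]
  linarith
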